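/- Assume the Hardy--Littlewood Conjecture: for all integers $a,b,c$ with $a>0$, $\gcd(a,b,c)=1$, $a+b$ and $c$ not both even, and $\Delta=b^2-4ac$ not a square, the number $P(n)$ of primes less than $n$ of the form $ax^2+bx+c$ with $x\in\{0,1,2,\dots\}$ satisfies $$P(n)\sim\delta(a,b,c)\frac{\sqrt n}{\log n}\quad(n\to\infty),\qquad \delta(a,b,c)=\frac{\gcd(2,a+b)}{\sqrt a}\prod_{\substack{p\mid a,\ p\mid b\\ p>2}}\frac p{p-1}\ \prod_{\substack{p\nmid a\\ p>2}}\Bigl(1-\frac{\left(\frac{\Delta}{p}\right)}{p-1}\Bigr),$$ where $\left(\frac{\cdot}{p}\right)$ is the Legendre symbol and the infinite product is taken over the primes in increasing order. For a nonzero integer $D$ let $E_D:y^2=x^3+Dx$ and, for a prime $p\nmid 2D$, let $a_p(E_D)=1+p-\#E_D(\mathbb F_p)$. For $r\in\mathbb Z$ and $N\ge 1$ let $Q(r,N)$ be the set of primes $p\le N$ of the form $p=r^2+x^2$ with $x\in\mathbb Z$, and put $$a_p(2r)=\lim_{N\to\infty}\frac{\#\{p\in Q(r,N): p\nmid 2D,\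 a_p(E_D)=2r\}}{\#Q(r,N)}.$$ For a prime $l$ and $k\ge1$ put $\tau(l^k)=l^k$ if $l=2$ or $l\equiv3\pmod 4$ and $\tau(l^k)=l^{k-1}(l-2)$ if $l\equiv1\pmod 4$; extend $\tau$ multiplicatively to the positive integers, with $\tau(1)=1$. Theorem. Let $D=\pm p_1\cdots p_r(q_1\cdots q_s)^2(l_1\cdots l_t)^3$, where $r,s,t\ge 0$ and $p_1,\dots,p_r,q_1,\dots,q_s,l_1,\dots,l_t$ are pairwise distinct odd primes. For $i\in\{1,7\}$ let $r_i$ (respectively $t_i$) be the number of primes among $p_1,\dots,p_r$ (respectively $l_1,\dots,l_t$) that are congruent to $i$ modulo $8$. Let $\alpha$ be an integer with $\alpha\equiv 1\pmod 4$ and $\gcd(D,\alpha)=1$. Then the densities $a_p(2\alpha)$ and $a_p(-2\alpha)$ exist, and: (1) if $D\equiv1\pmod4$, then $$a_p(\pm2\alpha)=\frac14\left(1+\frac{(-1)^{r+t}}{\tau(p_1\cdots p_rl_1\cdots l_t)}\pm\frac{2(-1)^{r_1+r_7+s+t_1+t_7}}{\tau(p_1\cdots p_rq_1\cdots q_sl_1\cdots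 l_t)}\right);$$ (2) if $D\equiv3\pmod4$, then $$a_p(2\alpha)=a_p(-2\alpha)=\frac14\left(1+\frac{(-1)^{r+t}}{\tau(p_1\cdots p_rl_1\cdots l_t)}\right).$$ -/

import Mathlib

open Filter Topology Asymptotics

noncomputable section

namespace LangTrotter

/-! ### The Hardy-Littlewood conjecture for primes of the form `a x ^ 2 + b x + c` -/

/-- The partial product, over the odd primes `p ≤ n` not dividing `a`, of
`1 - (D / p) / (p - 1)`, where `D = b ^ 2 - 4 a c` and `(D / p)` is the Legendre symbol. -/
def hlPartialProduct (a b c : ℤ) (n : ℕ) : ℝ :=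
  ∏ p ∈ (Finset.range (n + 1)).filter (fun p : ℕ => p.Prime ∧ 2 < p ∧ ¬ (p : ℤ) ∣ a),
    (1 - (jacobiSym (b ^ 2 - 4 * a * c) p : ℝ) / ((p : ℝ) - 1))

/-- The constant `δ(a, b, c)`. The (conditionally convergent) infinite product is taken over the
primes in increasing order. -/
def hlConstant (a b c : ℤ) : ℝ :=
  (Int.gcd 2 (a + b) : ℝ) / √(a : ℝ) *
    (∏ p ∈ a.natAbs.primeFactors.filter (fun p : ℕ => (p : ℤ) ∣ b ∧ 2 < p),
      (p : ℝ) / ((p : ℝ) - 1)) *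
    limUnder atTop (hlPartialProduct a b c)

/-- The number of primes less than `n` of the form `a x ^ 2 + b x + c` with `x = 0, 1, 2, …`. -/
def hlCount (a b c : ℤ) (n : ℕ) : ℕ :=
  {p : ℕ | p.Prime ∧ p < n ∧ ∃ x : ℕ, (p : ℤ) = a * (x : ℤ) ^ 2 + b * (x : ℤ) + c}.ncard

/-- The Hardy-Littlewood conjecture on primes represented by quadratic polynomials. -/
def HardyLittlewoodConjecture : Prop :=
  ∀ a b c : ℤ, 0 < a → Int.gcd a (Int.gcd b c) = 1 → ¬ (Even (a + b) ∧ Even c) →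
    ¬ IsSquare (b ^ 2 - 4 * a * c) →
    (fun n : ℕ => (hlCount a b c n : ℝ)) ~[atTop]
      (fun n : ℕ => hlConstant a b c * (√(n : ℝ) / Real.log (n : ℝ)))

/-! ### The elliptic curve `y ^ 2 = x ^ 3 + D x` and the density of `a_p = 2 r` -/

/-- The curve `E_D : y ^ 2 = x ^ 3 + D x`, over `ℤ`. -/
def curve (D : ℤ) : WeierstrassCurve ℤ where
  a₁ := 0
  a₂ := 0
  a₃ := 0
  a₄ := D
  a₆ := 0

/-- The trace of Frobenius `a_p(E_D) = 1 + p - #E_D(𝔽_p)` at a prime `p` of good reduction; the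
points of the reduction include the point at infinity. -/
def frobeniusTrace (D : ℤ) (p : ℕ) : ℤ :=
  1 + (p : ℤ) - (Nat.card ((curve D).map (Int.castRingHom (ZMod p))).toAffine.Point : ℤ)

/-- `Q(r, N)`: the primes `p ≤ N` of the form `p = r ^ 2 + x ^ 2`. -/
def primesOfForm (r : ℤ) (N : ℕ) : Set ℕ :=
  {p : ℕ | p.Prime ∧ p ≤ N ∧ ∃ x : ℤ, (p : ℤ) = r ^ 2 + x ^ 2}

/-- The primes `p ∈ Q(r, N)` of good reduction for `E_D` (that is, `p ∤ 2 D`) with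
`a_p(E_D) = 2 r`. -/
def primesWithTrace (D r : ℤ) (N : ℕ) : Set ℕ :=
  {p : ℕ | p ∈ primesOfForm r N ∧ ¬ (p : ℤ) ∣ 2 * D ∧ frobeniusTrace D p = 2 * r}

/-- The density `a_p(E_D, 2 r)` exists and equals `d`. -/
def HasTraceDensity (D r : ℤ) (d : ℝ) : Prop :=
  Tendsto (fun N : ℕ => ((primesWithTrace D r N).ncard : ℝ) / ((primesOfForm r N).ncard : ℝ))
    atTop (𝓝 d)

/-! ### Arithmetic notation -/

/-- `τ (l ^ k)` for a prime `l` and `k ≥ 1`. -/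
def tauPrimePow (l k : ℕ) : ℕ :=
  if l % 4 = 1 then l ^ (k - 1) * (l - 2) else l ^ k

/-- The multiplicative function `τ`. -/
def tau (n : ℕ) : ℕ :=
  ∏ l ∈ n.primeFactors, tauPrimePow l (n.factorization l)

/-- The number of `l ∈ S` with `l ≡ i (mod 8)`. -/
def countMod8 (S : Finset ℕ) (i : ℕ) : ℕ :=
  (S.filter (fun l => l % 8 = i)).card

end LangTrotter

end

/-!
# The density of primes with a given trace of Frobenius on `y² = x³ + D x`

Let `p = α² + x²` be a prime of good reduction with `α ≡ 1 (mod 4)`.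

*The trace.* Counting points on `y² = x³ + D x` gives a Jacobi sum: if `χ` is a quartic character
modulo `p` and `J = -χ(-1) J(χ, χ²)`, then `a_p = χ̄(D) J + χ(D) J̄` (`frobeniusTrace_eq_jacobi`).
Here `J J̄ = p` and `J ≡ χ(-1) (mod 2 + 2i)`, so that, after replacing `χ` by `χ̄` if necessary,
`J = α + x i` (`exists_quartic_normalizedJacobi`). Hence `a_p = ± 2 α` if and only if
`χ(D) = ± 1` (`frobeniusTrace_eq_iff`).

*Reciprocity.* For an odd prime `q ≠ p` let `q* = ± q ≡ 1 (mod 4)`. The fourth power of the Gauss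
sum of `χ` is `J³ J̄`, and applying the Frobenius of a field of characteristic `q` to this Gauss sum
yields `χ(q*) = (J / J̄) ^ ((q* - 1) / 4)` in that field (`quartic_reciprocity_of_one`,
`quartic_reciprocity_of_three`). So `χ(q*)` depends only on `x` modulo `q`. As `x` varies, `J / J̄`
runs once through the norm one group, which is cyclic of order `|q* - 1|`, except for the element
`-1`. This gives all moments of `χ(q*)` as a function of `x` (`exists_isLocalSymbol`). Together with
`χ(-1) = (-1) ^ ((p - 1) / 4)`, which depends on `x` modulo `4`, and the Chinese remainder theorem,
one obtains the moments, and hence the value distribution, of `χ(D)` as a function of `x` modulo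
`4 ∏ q` (`globalSymbol_moments`, `four_mul_card_filter`).

*Equidistribution.* The primes `α² + x²` with `x` in a fixed residue class `x₀` modulo `M` are the
primes represented by `M² y² + 2 M x₀ y + (x₀² + α²)`, of discriminant `-(2 M α)²`. The constant in
the Hardy-Littlewood conjecture is the same for all admissible `x₀`, so every admissible class
contains the same proportion of the primes (`hasTraceDensity_of_residues`), once this constant is
known to be positive. That amounts to the convergence of the Euler product of `1 / L(1, χ₄)` to a
nonzero limit, which follows as in Mertens' theorem from `L(1, χ₄) ≠ 0` and Chebyshev's bound
(`exists_tendsto_hlPartialProduct`).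
-/

namespace LangTrotter

/-! ### Quartic characters with values in the Gaussian integers -/

/-- The imaginary unit of `ℤ[i]`. -/
def gaussI : GaussianInt := ⟨0, 1⟩

lemma gaussI_sq : gaussI ^ 2 = -1 := by
  rw [sq]; decide

lemma fourth_root_cases {R : Type*} [CommRing R] [IsDomain R] {j w : R} (hj : j ^ 2 = -1)
    (hw : w ^ 4 = 1) : w = 1 ∨ w = -1 ∨ w = j ∨ w = -j := by
  have h : (w - 1) * ((w + 1) * ((w - j) * (w + j))) = 0 := by
    linear_combination hw - (w ^ 2 - 1) * hj
  rcases mul_eq_zero.1 h with h | h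
  · exact Or.inl (sub_eq_zero.1 h)
  rcases mul_eq_zero.1 h with h | h
  · exact Or.inr (Or.inl (eq_neg_of_add_eq_zero_left h))
  rcases mul_eq_zero.1 h with h | h
  · exact Or.inr (Or.inr (Or.inl (sub_eq_zero.1 h)))
  · exact Or.inr (Or.inr (Or.inr (eq_neg_of_add_eq_zero_left h)))

lemma gaussI_isPrimitiveRoot : IsPrimitiveRoot gaussI 4 := by
  rw [show (4 : ℕ) = 2 ^ (1 + 1) from rfl]
  refine IsPrimitiveRoot.iff_orderOf.2 (orderOf_eq_prime_pow ?_ ?_)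
  · rw [pow_one, gaussI_sq]; decide
  · rw [show (2 : ℕ) ^ (1 + 1) = 2 * 2 from rfl, pow_mul, gaussI_sq]; decide

lemma star_eq_inv_of_fourth_root {w : GaussianInt} (hw : w ^ 4 = 1) : w * star w = 1 := by
  rcases fourth_root_cases gaussI_sq hw with rfl | rfl | rfl | rfl <;> decide

section Character

variable {p : ℕ}

lemma exists_quartic_character [Fact p.Prime] (hp : p % 4 = 1) :
    ∃ χ : MulChar (ZMod p) GaussianInt, orderOf χ = 4 := by
  refine MulChar.exists_mulChar_orderOf (ZMod p) ?_ gaussI_isPrimitiveRoot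
  rw [ZMod.card]; omega

variable {χ : MulChar (ZMod p) GaussianInt}

lemma quartic_pow_four (hχ : orderOf χ = 4) : χ ^ 4 = 1 := hχ ▸ pow_orderOf_eq_one χ

lemma quartic_sq_ne_one (hχ : orderOf χ = 4) : χ ^ 2 ≠ 1 :=
  pow_ne_one_of_lt_orderOf (by norm_num) (by rw [hχ]; norm_num)

lemma quartic_inv (hχ : orderOf χ = 4) : orderOf χ⁻¹ = 4 := by rw [orderOf_inv, hχ]

lemma quartic_ne_one (hχ : orderOf χ = 4) : χ ≠ 1 := by
  rintro rfl; exact quartic_sq_ne_one hχ (one_pow 2)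

lemma quartic_cube (hχ : orderOf χ = 4) : χ * χ ^ 2 = χ⁻¹ := by
  refine eq_inv_of_mul_eq_one_left ?_
  rw [← quartic_pow_four hχ, ← pow_succ', ← pow_succ]

lemma quartic_inv_sq (hχ : orderOf χ = 4) : χ⁻¹ ^ 2 = χ ^ 2 := by
  rw [inv_pow]; refine inv_eq_of_mul_eq_one_left ?_
  rw [← pow_add, quartic_pow_four hχ]

variable [Fact p.Prime]

lemma quartic_apply_pow_four (hχ : orderOf χ = 4) {a : ZMod p} (ha : a ≠ 0) : χ a ^ 4 = 1 := by
  rw [← MulChar.pow_apply' χ (by norm_num), quartic_pow_four hχ, MulChar.one_apply ha.isUnit]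

lemma quartic_inv_apply (hχ : orderOf χ = 4) (a : ZMod p) : χ⁻¹ a = star (χ a) := by
  by_cases ha : a = 0
  · rw [ha, MulChar.map_zero, MulChar.map_zero, star_zero]
  have h1 := star_eq_inv_of_fourth_root (quartic_apply_pow_four hχ ha)
  have h2 : χ a * χ⁻¹ a = 1 := by
    rw [← MulChar.mul_apply, mul_inv_cancel, MulChar.one_apply (Ne.isUnit ha)]
  calc χ⁻¹ a = χ⁻¹ a * (χ a * star (χ a)) := by rw [h1, mul_one]
    _ = χ a * χ⁻¹ a * star (χ a) := by ring
    _ = star (χ a) := by rw [h2, one_mul]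

lemma ringHomComp_star (hχ : orderOf χ = 4) :
    χ.ringHomComp (starRingEnd GaussianInt) = χ⁻¹ := by
  ext a : 1
  exact (quartic_inv_apply hχ a).symm

/-- The square of a quartic character is the quadratic character: it is trivial on squares, and if
it took the value `1` at one nonsquare, it would do so at all of them. -/
lemma quartic_sq (hp : p % 4 = 1) (hχ : orderOf χ = 4) (a : ZMod p) :
    χ a ^ 2 = (quadraticChar (ZMod p) a : GaussianInt) := by
  have hc : ringChar (ZMod p) ≠ 2 := by rw [ZMod.ringChar_zmod_n]; omega
  by_cases ha : a = 0
  · simp [ha, MulChar.map_zero]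
  have hsq : ∀ b : ZMod p, b ≠ 0 → IsSquare b → χ b ^ 2 = 1 := by
    rintro b hb ⟨c, rfl⟩
    have hc : c ≠ 0 := by rintro rfl; simp at hb
    rw [map_mul, ← quartic_apply_pow_four hχ hc]; ring
  by_cases hs : IsSquare a
  · rw [hsq a ha hs, (quadraticChar_one_iff_isSquare ha).2 hs, Int.cast_one]
  rw [quadraticChar_neg_one_iff_not_isSquare.2 hs, Int.cast_neg, Int.cast_one]
  have h4 : (χ a ^ 2 - 1) * (χ a ^ 2 + 1) = 0 := by
    linear_combination quartic_apply_pow_four hχ ha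
  rcases mul_eq_zero.1 h4 with h | h
  · exfalso
    apply quartic_sq_ne_one hχ
    ext b : 1
    rw [MulChar.pow_apply_coe, MulChar.one_apply_coe]
    by_cases hb : IsSquare (b : ZMod p)
    · exact hsq _ b.ne_zero hb
    · have hab : IsSquare (a * (b : ZMod p)) := by
        rw [← quadraticChar_one_iff_isSquare (mul_ne_zero ha b.ne_zero), map_mul,
          quadraticChar_neg_one_iff_not_isSquare.2 hs,
          quadraticChar_neg_one_iff_not_isSquare.2 hb]
        norm_num
      have := hsq _ (mul_ne_zero ha b.ne_zero) hab
      rw [map_mul, mul_pow, sub_eq_zero.1 h, one_mul] at this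
      exact this
  · exact eq_neg_of_add_eq_zero_left h

lemma quartic_neg_one_sq : χ (-1) ^ 2 = 1 := by
  rw [← map_pow, neg_one_sq, map_one]

/-- The Jacobi sum `-χ(-1) J(χ, χ²)`. It is the Gaussian prime above `p` that governs both the
trace of Frobenius of `y² = x³ + D x` and the fourth power of the Gauss sum of `χ`. -/
noncomputable def normalizedJacobi (χ : MulChar (ZMod p) GaussianInt) : GaussianInt :=
  -χ (-1) * jacobiSum χ (χ ^ 2)

lemma star_normalizedJacobi (hχ : orderOf χ = 4) :
    star (normalizedJacobi χ) = normalizedJacobi χ⁻¹ := by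
  rw [normalizedJacobi, normalizedJacobi, ← starRingEnd_apply, map_mul, map_neg,
    ← jacobiSum_ringHomComp, ← MulChar.ringHomComp_pow, ringHomComp_star hχ,
    starRingEnd_apply, quartic_inv_apply hχ]

lemma normalizedJacobi_sq :
    normalizedJacobi χ ^ 2 = jacobiSum χ (χ ^ 2) ^ 2 := by
  rw [normalizedJacobi, mul_pow, neg_sq, quartic_neg_one_sq, one_mul]

lemma normalizedJacobi_mul_star (hχ : orderOf χ = 4) :
    normalizedJacobi χ * star (normalizedJacobi χ) = (p : GaussianInt) := by
  have hinj : Function.Injective GaussianInt.toComplex := GaussianInt.toComplex_injective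
  have hne : ∀ ψ : MulChar (ZMod p) GaussianInt, ψ ≠ 1 →
      ψ.ringHomComp GaussianInt.toComplex ≠ 1 := fun ψ h =>
    (MulChar.ringHomComp_ne_one_iff hinj).2 h
  have h := jacobiSum_mul_jacobiSum_inv (F := ZMod p) (F' := ℂ)
    (χ := χ.ringHomComp GaussianInt.toComplex) (φ := (χ ^ 2).ringHomComp GaussianInt.toComplex)
    (by rw [ringChar.eq_zero, ZMod.ringChar_zmod_n]; exact (Fact.out : p.Prime).ne_zero.symm)
    (hne _ (quartic_ne_one hχ)) (hne _ (quartic_sq_ne_one hχ))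
    (by
      rw [← MulChar.ringHomComp_mul, quartic_cube hχ]
      exact hne _ (inv_ne_one.2 (quartic_ne_one hχ)))
  rw [MulChar.ringHomComp_inv, MulChar.ringHomComp_inv, jacobiSum_ringHomComp,
    jacobiSum_ringHomComp, ← map_mul, ZMod.card, ← map_natCast GaussianInt.toComplex] at h
  rw [star_normalizedJacobi hχ, ← hinj h, normalizedJacobi, normalizedJacobi, inv_pow,
    quartic_inv_apply hχ]
  have := star_eq_inv_of_fourth_root (quartic_apply_pow_four hχ (neg_ne_zero.2 (one_ne_zero)))
  linear_combination (jacobiSum χ (χ ^ 2) * jacobiSum χ⁻¹ (χ ^ 2)⁻¹) * this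

/-- The normalisation of the Jacobi sum modulo `2 + 2i`: in
`∑ (χ v - 1) (χ² (1 - v) - 1)`, over `v ≠ 0, 1`, every term is divisible by `(1 - i) * 2`. -/
lemma dvd_normalizedJacobi_sub (hp : p % 4 = 1) (hχ : orderOf χ = 4) :
    (2 + 2 * gaussI) ∣ normalizedJacobi χ - χ (-1) := by
  have key : (2 + 2 * gaussI) ∣ jacobiSum χ (χ ^ 2) + (p : GaussianInt) := by
    have hsum : ∑ v : ZMod p, (χ v - 1) * ((χ ^ 2) (1 - v) - 1)
        = jacobiSum χ (χ ^ 2) + (p : GaussianInt) := by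
      have h1 : ∑ v : ZMod p, χ v = 0 := MulChar.sum_eq_zero_of_ne_one (quartic_ne_one hχ)
      have h2 : ∑ v : ZMod p, (χ ^ 2) (1 - v) = 0 := by
        rw [← MulChar.sum_eq_zero_of_ne_one (quartic_sq_ne_one hχ)]
        exact (Equiv.subLeft (1 : ZMod p)).sum_comp (fun v => (χ ^ 2) v)
      calc ∑ v : ZMod p, (χ v - 1) * ((χ ^ 2) (1 - v) - 1)
          = ∑ v : ZMod p, (χ v * (χ ^ 2) (1 - v) - χ v - (χ ^ 2) (1 - v) + 1) :=
            Finset.sum_congr rfl fun v _ => by ring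
        _ = jacobiSum χ (χ ^ 2) - 0 - 0 + (p : GaussianInt) := by
            rw [Finset.sum_add_distrib, Finset.sum_sub_distrib, Finset.sum_sub_distrib, h1, h2]
            simp [jacobiSum]
        _ = _ := by ring
    rw [← hsum]
    refine Finset.dvd_sum fun v _ => ?_
    by_cases hv0 : v = 0
    · simp [hv0]
    by_cases hv1 : 1 - v = 0
    · rw [show v = 1 from (sub_eq_zero.1 hv1).symm]; simp
    -- `1 - i` divides `w - 1` for every fourth root of unity `w`, and `2` divides `±1 - 1`
    have ha : (1 - gaussI) ∣ χ v - 1 := by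
      rcases fourth_root_cases gaussI_sq (quartic_apply_pow_four hχ hv0) with h | h | h | h <;>
        rw [h]
      · simp
      · exact ⟨-(1 + gaussI), by linear_combination -gaussI_sq⟩
      · exact ⟨-1, by ring⟩
      · exact ⟨-gaussI, by linear_combination -gaussI_sq⟩
    have hb : (2 : GaussianInt) ∣ (χ ^ 2) (1 - v) - 1 := by
      rw [MulChar.pow_apply' χ (by norm_num)]
      have := quartic_apply_pow_four hχ hv1
      have h4 : (χ (1 - v) ^ 2 - 1) * (χ (1 - v) ^ 2 + 1) = 0 := by linear_combination this
      rcases mul_eq_zero.1 h4 with h | h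
      · rw [h]; simp
      · rw [eq_neg_of_add_eq_zero_left h]; exact ⟨-1, by ring⟩
    refine Dvd.dvd.trans ⟨-gaussI, ?_⟩ (mul_dvd_mul ha hb)
    linear_combination 2 * gaussI_sq
  have h4 : (2 + 2 * gaussI) ∣ ((p : GaussianInt) - 1) := by
    refine Dvd.dvd.trans ⟨1 - gaussI, ?_⟩ (b := 4) ?_
    · linear_combination 2 * gaussI_sq
    · refine ⟨((p / 4 : ℕ) : GaussianInt), ?_⟩
      have : p = 4 * (p / 4) + 1 := by omega
      conv_lhs => rw [this]
      push_cast; ring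
  have : normalizedJacobi χ - χ (-1)
      = -χ (-1) * (jacobiSum χ (χ ^ 2) + p) + χ (-1) * (p - 1) := by
    rw [normalizedJacobi]; ring
  rw [this]
  exact dvd_add (Dvd.dvd.mul_left key _) (Dvd.dvd.mul_left h4 _)

end Character

/-! ### The trace of Frobenius as a Jacobi sum -/

section Trace

variable {p : ℕ} [Fact p.Prime]

lemma card_point_curve (D : ℤ) (hD : ¬ (p : ℤ) ∣ 2 * D) :
    Nat.card ((curve D).map (Int.castRingHom (ZMod p))).toAffine.Point
      = Nat.card {z : ZMod p × ZMod p // z.2 ^ 2 = z.1 ^ 3 + D * z.1} + 1 := by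
  set W := ((curve D).map (Int.castRingHom (ZMod p))).toAffine with hW
  have hΔ : W.Δ ≠ 0 := by
    have h2 : W.Δ = ((-64 * D ^ 3 : ℤ) : ZMod p) := by
      simp only [hW, WeierstrassCurve.Δ, WeierstrassCurve.b₂, WeierstrassCurve.b₄,
        WeierstrassCurve.b₆, WeierstrassCurve.b₈, WeierstrassCurve.map, curve]
      simp; ring
    rw [h2, Ne, ZMod.intCast_zmod_eq_zero_iff_dvd]
    intro h
    have hp : Prime (p : ℤ) := Nat.prime_iff_prime_int.1 Fact.out
    apply hD
    rcases hp.dvd_or_dvd h with h | h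
    · rw [show (-64 : ℤ) = -2 ^ 6 from by norm_num, dvd_neg] at h
      exact (hp.dvd_of_dvd_pow h).mul_right _
    · exact (hp.dvd_of_dvd_pow h).mul_left _
  have heq : ∀ x y : ZMod p, W.Nonsingular x y ↔ y ^ 2 = x ^ 3 + D * x := by
    intro x y
    rw [← W.equation_iff_nonsingular_of_Δ_ne_zero hΔ, WeierstrassCurve.Affine.equation_iff]
    simp [hW, WeierstrassCurve.map, curve]
  let e : W.Point ≃ Option {z : ZMod p × ZMod p // z.2 ^ 2 = z.1 ^ 3 + D * z.1} :=
    { toFun := fun P => match P with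
        | .zero => none
        | .some x y h => some ⟨(x, y), (heq x y).1 h⟩
      invFun := fun o => match o with
        | none => .zero
        | some z => .some z.1.1 z.1.2 ((heq _ _).2 z.2)
      left_inv := fun P => by cases P <;> rfl
      right_inv := fun o => by cases o <;> rfl }
  rw [Nat.card_congr e, Finite.card_option]

lemma card_sqrts (hp : p % 4 = 1) (a : ZMod p) :
    ((Finset.univ.filter fun x : ZMod p => x ^ 2 = a).card : ℤ)
      = quadraticChar (ZMod p) a + 1 := by
  rw [← quadraticChar_card_sqrts (by rw [ZMod.ringChar_zmod_n]; omega) a]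
  congr 2; ext; simp

lemma frobeniusTrace_eq_sum (hp : p % 4 = 1) (D : ℤ) (hD : ¬ (p : ℤ) ∣ 2 * D) :
    frobeniusTrace D p = -∑ x : ZMod p, quadraticChar (ZMod p) (x ^ 3 + D * x) := by
  have hcard : (Nat.card {z : ZMod p × ZMod p // z.2 ^ 2 = z.1 ^ 3 + D * z.1} : ℤ)
      = ∑ x : ZMod p, (quadraticChar (ZMod p) (x ^ 3 + D * x) + 1) := by
    rw [Nat.card_eq_fintype_card, Fintype.card_subtype, Finset.card_filter,
      Fintype.sum_prod_type, Nat.cast_sum]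
    refine Finset.sum_congr rfl fun x _ => ?_
    rw [← card_sqrts hp, Finset.card_filter]
  rw [frobeniusTrace, card_point_curve D hD, Nat.cast_add, hcard, Finset.sum_add_distrib]
  simp only [Finset.sum_const, Finset.card_univ, ZMod.card, nsmul_eq_mul, mul_one, Nat.cast_one]
  ring

variable {χ : MulChar (ZMod p) GaussianInt}

/-- The substitution `u = -d v` reduces this sum to the Jacobi sum of `χ` and `χ²`. -/
lemma sum_quartic_shift (hχ : orderOf χ = 4) {d : ZMod p} (hd : d ≠ 0) :
    ∑ u : ZMod p, χ u * (χ ^ 2) (u + d) = -(star (χ d) * normalizedJacobi χ) := by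
  have h4 := quartic_apply_pow_four hχ hd
  have h1 := star_eq_inv_of_fourth_root h4
  have hu : IsUnit (-d) := (neg_ne_zero.2 hd).isUnit
  calc ∑ u : ZMod p, χ u * (χ ^ 2) (u + d)
      = ∑ v : ZMod p, χ (-d * v) * (χ ^ 2) (-d * v + d) :=
        (Fintype.sum_bijective (fun v => -d * v) (hu.unit.mulLeft_bijective) _ _
          fun v => rfl).symm
    _ = ∑ v : ZMod p, χ (-1) * χ d ^ 3 * (χ v * (χ ^ 2) (1 - v)) := by
        refine Finset.sum_congr rfl fun v _ => ?_
        rw [show -d * v + d = d * (1 - v) by ring, show -d * v = -1 * d * v by ring,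
          map_mul, map_mul, map_mul, MulChar.pow_apply' χ two_ne_zero d]
        ring
    _ = χ (-1) * star (χ d) * jacobiSum χ (χ ^ 2) := by
        rw [← Finset.mul_sum, jacobiSum]
        congr 2
        linear_combination (-(χ d) ^ 3) * h1 + star (χ d) * h4
    _ = _ := by rw [normalizedJacobi]; ring

/-- The trace of Frobenius in terms of the Jacobi sum: substitute `u = x²` in
`∑ φ(x) φ(x² + D) = ∑ χ(x²) φ(x² + D)`. -/
lemma frobeniusTrace_eq_jacobi (hp : p % 4 = 1) (hχ : orderOf χ = 4) (D : ℤ)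
    (hD : ¬ (p : ℤ) ∣ 2 * D) :
    (frobeniusTrace D p : GaussianInt)
      = star (χ D) * normalizedJacobi χ + χ D * star (normalizedJacobi χ) := by
  have hd : (D : ZMod p) ≠ 0 := by
    rw [Ne, ZMod.intCast_zmod_eq_zero_iff_dvd]
    exact fun h => hD (h.mul_left 2)
  have hφ : ∀ a : ZMod p, (quadraticChar (ZMod p) a : GaussianInt) = (χ ^ 2) a := fun a => by
    rw [← quartic_sq hp hχ, MulChar.pow_apply' χ two_ne_zero]
  have h1 := sum_quartic_shift hχ hd
  have h2 := sum_quartic_shift (quartic_inv hχ) hd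
  rw [quartic_inv_sq hχ, ← star_normalizedJacobi hχ, quartic_inv_apply hχ, star_star] at h2
  have h3 : ∑ x : ZMod p, (χ ^ 2) (x ^ 3 + D * x)
      = ∑ u : ZMod p, χ u * (χ ^ 2) (u + D) + ∑ u : ZMod p, χ⁻¹ u * (χ ^ 2) (u + D) := by
    calc ∑ x : ZMod p, (χ ^ 2) (x ^ 3 + D * x)
        = ∑ x : ZMod p, χ (x ^ 2) * (χ ^ 2) (x ^ 2 + D) := by
          refine Finset.sum_congr rfl fun x _ => ?_
          rw [show x ^ 3 + D * x = x * (x ^ 2 + D) by ring, map_mul,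
            MulChar.pow_apply' χ two_ne_zero x, map_pow]
      _ = ∑ u : ZMod p, ∑ x ∈ Finset.univ.filter (fun x : ZMod p => x ^ 2 = u),
            χ (x ^ 2) * (χ ^ 2) (x ^ 2 + D) := (Finset.sum_fiberwise _ _ _).symm
      _ = ∑ u : ZMod p, (χ u * (χ ^ 2) (u + D) + χ⁻¹ u * (χ ^ 2) (u + D)) := by
          refine Finset.sum_congr rfl fun u _ => ?_
          rw [Finset.sum_congr rfl (g := fun _ => χ u * (χ ^ 2) (u + D))
            (fun x hx => by rw [(Finset.mem_filter.1 hx).2]), Finset.sum_const, nsmul_eq_mul]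
          have := congrArg (Int.cast (R := GaussianInt)) (card_sqrts hp u)
          push_cast at this
          rw [this, hφ, ← quartic_cube hχ, MulChar.mul_apply]
          ring
      _ = _ := Finset.sum_add_distrib
  rw [frobeniusTrace_eq_sum hp D hD]
  push_cast
  simp_rw [hφ]
  rw [h3, h1, h2]
  ring

lemma two_add_two_I_dvd {a b : ℤ} (h : (2 + 2 * gaussI) ∣ (⟨a, b⟩ : GaussianInt)) :
    ∃ c d : ℤ, a = 2 * c - 2 * d ∧ b = 2 * c + 2 * d := by
  obtain ⟨⟨c, d⟩, hz⟩ := h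
  have h1 := congrArg Zsqrtd.re hz
  have h2 := congrArg Zsqrtd.im hz
  simp [gaussI] at h1 h2
  exact ⟨c, d, by linarith, by linarith⟩

/-- `χ(-1) = (-1) ^ ((p - 1) / 4)`: if `j² = -1`, then `χ(-1)` is the Legendre symbol of `j`, to
which Euler's criterion applies. -/
lemma quartic_neg_one (hp : p % 4 = 1) (hχ : orderOf χ = 4) :
    χ (-1) = if p % 8 = 1 then 1 else -1 := by
  obtain ⟨j, hj⟩ : IsSquare (-1 : ZMod p) := ZMod.exists_sq_eq_neg_one_iff.2 (by omega)
  have hj0 : j ≠ 0 := by rintro rfl; simp at hj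
  have hq := quadraticChar_eq_pow_of_char_ne_two' (F := ZMod p)
    (by rw [ZMod.ringChar_zmod_n]; omega) j
  have hne : (1 : ZMod p) ≠ -1 := by
    have := Fact.mk (show 2 < p by have := (Fact.out : p.Prime).two_le; omega)
    exact (ZMod.neg_one_ne_one).symm
  rw [hj, map_mul, ← sq, quartic_sq hp hχ]
  rw [ZMod.card, show p / 2 = 2 * (p / 4) by omega, pow_mul, sq, ← hj] at hq
  split_ifs with h8
  · rw [Even.neg_one_pow (by rw [Nat.even_iff]; omega)] at hq
    rcases quadraticChar_dichotomy hj0 with h | h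
    · rw [h, Int.cast_one]
    · rw [h] at hq; push_cast at hq; exact absurd hq.symm hne
  · rw [Odd.neg_one_pow (by rw [Nat.odd_iff]; omega)] at hq
    rcases quadraticChar_dichotomy hj0 with h | h
    · rw [h] at hq; push_cast at hq; exact absurd hq hne
    · rw [h, Int.cast_neg, Int.cast_one]

/-- In `p = α² + x²` with `α` odd, `x` is even and its class modulo `4` is decided by `p` modulo
`8`. -/
lemma mod_eight_of_sum_sq {α x : ℤ} (hα : α ≡ 1 [ZMOD 4]) (hp2 : p ≠ 2)
    (hpx : (p : ℤ) = α ^ 2 + x ^ 2) :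
    (x % 4 = 0 ∧ p % 8 = 1) ∨ (x % 4 = 2 ∧ p % 8 = 5) := by
  have hodd : p % 2 = 1 := (Nat.Prime.eq_two_or_odd Fact.out).resolve_left hp2
  have hα' : α % 4 = 1 := hα
  have ha : α ^ 2 % 8 = 1 := by
    rw [sq, Int.mul_emod]
    rcases (show α % 8 = 1 ∨ α % 8 = 5 by omega) with h | h <;> rw [h] <;> norm_num
  have hx : (x % 4 = 0 ∧ x ^ 2 % 8 = 0) ∨ (x % 4 = 2 ∧ x ^ 2 % 8 = 4) ∨ x ^ 2 % 2 = 1 := by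
    have h2 : x ^ 2 % 8 = (x % 8) * (x % 8) % 8 := by rw [sq, Int.mul_emod]
    have : x % 8 = 0 ∨ x % 8 = 1 ∨ x % 8 = 2 ∨ x % 8 = 3 ∨ x % 8 = 4 ∨ x % 8 = 5 ∨ x % 8 = 6 ∨
      x % 8 = 7 := by omega
    rcases this with h | h | h | h | h | h | h | h <;> rw [h] at h2 <;> norm_num at h2 <;> omega
  omega

/-- The odd term in a representation of a prime as a sum of two squares is unique up to sign. -/
lemma sum_sq_unique {p : ℕ} (hp : p.Prime) {a b c d : ℤ} (h1 : (p : ℤ) = a ^ 2 + b ^ 2)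
    (h2 : (p : ℤ) = c ^ 2 + d ^ 2) (ha : Odd a) (hc : Odd c) (hb : Even b) :
    a ^ 2 = c ^ 2 := by
  have hp' : Prime (p : ℤ) := Nat.prime_iff_prime_int.1 hp
  have key : ∀ b : ℤ, Even b → (p : ℤ) = a ^ 2 + b ^ 2 → (p : ℤ) ∣ a * c - b * d →
      a ^ 2 = c ^ 2 := by
    rintro b hb h1 ⟨k, hk⟩
    have hsq : (p : ℤ) ^ 2 = (p * k) ^ 2 + (a * d + b * c) ^ 2 := by
      calc (p : ℤ) ^ 2 = (a ^ 2 + b ^ 2) * (c ^ 2 + d ^ 2) := by rw [← h1, ← h2, sq]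
        _ = (a * c - b * d) ^ 2 + (a * d + b * c) ^ 2 := by ring
        _ = _ := by rw [hk]
    have hk0 : k ≠ 0 := by
      rintro rfl
      have h3 : Odd (a * c) := ha.mul hc
      rw [show a * c = b * d by linarith] at h3
      exact (Int.not_even_iff_odd.2 h3) (hb.mul_right d)
    have hpos : (0 : ℤ) < p := by exact_mod_cast hp.pos
    have hk1 : 1 ≤ k ^ 2 := by
      have := sq_nonneg k
      have := pow_ne_zero 2 hk0
      omega
    have hz : (a * d + b * c) ^ 2 = 0 := by
      nlinarith [sq_nonneg (a * d + b * c), mul_pos hpos hpos]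
    have hz' : a * d = -(b * c) := eq_neg_of_add_eq_zero_left (pow_eq_zero_iff two_ne_zero |>.1 hz)
    have h5 : (p : ℤ) * (a ^ 2 - c ^ 2) = 0 := by
      have h6 : (a * d) ^ 2 = (b * c) ^ 2 := by rw [hz', neg_sq]
      linear_combination a ^ 2 * h2 - c ^ 2 * h1 + h6
    linarith [(mul_eq_zero.1 h5).resolve_left hpos.ne']
  -- `(ac - bd)(ac + bd) = p (a² - d²)`, and the two factors are exchanged by `b ↦ -b`
  have hdvd : (p : ℤ) ∣ (a * c - b * d) * (a * c - -b * d) :=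
    ⟨a ^ 2 - d ^ 2, by linear_combination -a ^ 2 * h2 + d ^ 2 * h1⟩
  rcases hp'.dvd_or_dvd hdvd with h | h
  · exact key b hb h1 h
  · exact key (-b) hb.neg (by rw [neg_sq, h1]) h

/-- Some quartic character modulo `p = α² + x²` has Jacobi sum exactly `α + x i`. The congruence
modulo `2 + 2i` forces the real part to be `≡ 1 (mod 4)`, hence equal to `α`; the sign of the
imaginary part is adjusted by passing to `χ⁻¹`. -/
lemma exists_quartic_normalizedJacobi {α x : ℤ} (hα : α ≡ 1 [ZMOD 4]) (hp2 : p ≠ 2)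
    (hpx : (p : ℤ) = α ^ 2 + x ^ 2) :
    ∃ χ : MulChar (ZMod p) GaussianInt, orderOf χ = 4 ∧ normalizedJacobi χ = ⟨α, x⟩ := by
  have h8 := mod_eight_of_sum_sq hα hp2 hpx
  have hp4 : p % 4 = 1 := by omega
  have hα' : α % 4 = 1 := hα
  obtain ⟨χ, hχ⟩ := exists_quartic_character hp4
  obtain ⟨a, b, hJ⟩ : ∃ a b : ℤ, normalizedJacobi χ = ⟨a, b⟩ := ⟨_, _, rfl⟩
  have hnorm : (p : ℤ) = a ^ 2 + b ^ 2 := by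
    have := congrArg Zsqrtd.re (normalizedJacobi_mul_star hχ)
    rw [hJ] at this
    simp at this
    linarith
  have hdvd := dvd_normalizedJacobi_sub hp4 hχ
  have hab : ∃ e c d : ℤ, a = e + 2 * c - 2 * d ∧ b = 2 * c + 2 * d ∧
      e = if p % 8 = 1 then 1 else -1 := by
    rw [quartic_neg_one hp4 hχ, hJ] at hdvd
    split_ifs at hdvd with h
    · obtain ⟨c, d, h1, h2⟩ := two_add_two_I_dvd (a := a - 1) (b := b) (by
        convert hdvd using 1
        ext <;> simp)
      exact ⟨1, c, d, by linarith, h2, by rw [if_pos h]⟩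
    · obtain ⟨c, d, h1, h2⟩ := two_add_two_I_dvd (a := a + 1) (b := b) (by
        convert hdvd using 1
        ext <;> simp)
      exact ⟨-1, c, d, by linarith, h2, by rw [if_neg h]⟩
  obtain ⟨e, c, d, h1, h2, he⟩ := hab
  have hodd : Odd a := by
    rw [Int.odd_iff]; split_ifs at he <;> omega
  have hsq := sum_sq_unique Fact.out hnorm hpx hodd (by rw [Int.odd_iff]; omega)
    (by rw [Int.even_iff]; omega)
  have hbx : b = x ∨ b = -x := sq_eq_sq_iff_eq_or_eq_neg.1 (by linarith)
  have haα : a = α := by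
    rcases sq_eq_sq_iff_eq_or_eq_neg.1 hsq with h | h
    · exact h
    · exfalso; split_ifs at he <;> omega
  rcases hbx with rfl | rfl
  · exact ⟨χ, hχ, by rw [hJ, haα]⟩
  · refine ⟨χ⁻¹, quartic_inv hχ, ?_⟩
    rw [← star_normalizedJacobi hχ, hJ, haα]
    ext <;> simp

/-- The trace is `± 2 α` if `χ(D) = ± 1`; for `χ(D) = ± i` it is `± 2 x`, which differs from
`± 2 α` because `x` is even and `α` is odd. -/
lemma frobeniusTrace_eq_iff {α x : ℤ} (hα : α ≡ 1 [ZMOD 4]) (hpx : (p : ℤ) = α ^ 2 + x ^ 2)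
    (hχ : orderOf χ = 4) (hJ : normalizedJacobi χ = ⟨α, x⟩) (D : ℤ) (hD : ¬ (p : ℤ) ∣ 2 * D) :
    (frobeniusTrace D p = 2 * α ↔ χ D = 1) ∧ (frobeniusTrace D p = 2 * (-α) ↔ χ D = -1) := by
  have hp2 : p ≠ 2 := by rintro rfl; exact hD (Dvd.intro _ rfl)
  have h8 := mod_eight_of_sum_sq hα hp2 hpx
  have hα' : α % 4 = 1 := hα
  have hd : (D : ZMod p) ≠ 0 := by
    rw [Ne, ZMod.intCast_zmod_eq_zero_iff_dvd]
    exact fun h => hD (h.mul_left 2)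
  have h := congrArg Zsqrtd.re (frobeniusTrace_eq_jacobi (by omega) hχ D hD)
  rw [hJ] at h
  rcases fourth_root_cases gaussI_sq (quartic_apply_pow_four hχ hd) with hc | hc | hc | hc <;>
    rw [hc] at h ⊢ <;> simp [gaussI] at h
  · exact ⟨⟨fun _ => rfl, fun _ => by omega⟩, fun _ => by omega, fun h' => absurd h' (by decide)⟩
  · exact ⟨⟨fun _ => by omega, fun h' => absurd h' (by decide)⟩, fun _ => rfl, fun _ => by omega⟩
  · have h1 : ¬ gaussI = 1 := by decide
    have h2 : ¬ gaussI = -1 := by decide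
    simp only [h1, h2, iff_false]; omega
  · have h1 : ¬ -gaussI = 1 := by decide
    have h2 : ¬ -gaussI = -1 := by decide
    simp only [h1, h2, iff_false]; omega

end Trace

/-! ### Quartic reciprocity for rational primes -/

section Reduction

variable {q : ℕ} [Fact q.Prime] {K : Type*} [Field K] [CharP K q]

lemma two_ne_zero_of_charP (hq : q ≠ 2) : (2 : K) ≠ 0 := by
  intro h
  have : q ∣ 2 := (CharP.cast_eq_zero_iff K q 2).1 (by exact_mod_cast h)
  exact hq ((Nat.prime_dvd_prime_iff_eq Fact.out Nat.prime_two).1 this)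

lemma map_gaussI_sq (f : GaussianInt →+* K) : f gaussI ^ 2 = -1 := by
  rw [← map_pow, gaussI_sq, map_neg, map_one]

lemma map_gaussianInt (f : GaussianInt →+* K) (z : GaussianInt) :
    f z = (z.re : K) + z.im * f gaussI := by
  conv_lhs => rw [show z = (z.re : GaussianInt) + z.im * gaussI by ext <;> simp [gaussI]]
  rw [map_add, map_mul, map_intCast, map_intCast]

include q in
lemma eq_one_of_map_eq_one (hq : q ≠ 2) (f : GaussianInt →+* K) {w : GaussianInt}
    (hw : w ^ 4 = 1) (h : f w = 1) : w = 1 := by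
  have h2 := two_ne_zero_of_charP (K := K) hq
  have hI := map_gaussI_sq f
  have hne : (-1 : K) ≠ 1 := fun h => h2 (by linear_combination -h)
  rcases fourth_root_cases gaussI_sq hw with rfl | rfl | rfl | rfl
  · rfl
  · rw [map_neg, map_one] at h; exact absurd h hne
  · rw [h, one_pow] at hI; exact absurd hI.symm hne
  · rw [map_neg] at h; rw [← neg_sq, h, one_pow] at hI; exact absurd hI.symm hne

include q in
lemma eq_of_map_eq (hq : q ≠ 2) (f : GaussianInt →+* K) {v w : GaussianInt}
    (hv : v ^ 4 = 1) (hw : w ^ 4 = 1) (h : f v = f w) : v = w := by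
  have h1 := star_eq_inv_of_fourth_root hw
  have hs : star w ^ 4 = 1 := by rw [← star_pow, hw, star_one]
  have := eq_one_of_map_eq_one hq f (w := v * star w) (by rw [mul_pow, hv, hs, one_mul])
    (by rw [map_mul, h, ← map_mul, h1, map_one])
  calc v = v * (w * star w) := by rw [h1, mul_one]
    _ = (v * star w) * w := by ring
    _ = w := by rw [this, one_mul]

lemma map_pow_char_of_one (hq : q % 4 = 1) (f : GaussianInt →+* K) (z : GaussianInt) :
    f z ^ q = f z := by
  have hI := map_gaussI_sq f
  have hIq : f gaussI ^ q = f gaussI := by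
    rw [show q = 2 * (2 * (q / 4)) + 1 by omega, pow_succ, pow_mul, hI,
      pow_mul, neg_one_sq, one_pow, one_mul]
  rw [← frobenius_def, map_gaussianInt f z, map_add, map_mul, map_intCast, map_intCast,
    frobenius_def, hIq]

lemma map_pow_char_of_three (hq : q % 4 = 3) (f : GaussianInt →+* K) (z : GaussianInt) :
    f z ^ q = f (star z) := by
  have hI := map_gaussI_sq f
  have hIq : f gaussI ^ q = -f gaussI := by
    rw [show q = 2 * (2 * (q / 4) + 1) + 1 by omega, pow_succ, pow_mul, hI,
      pow_succ, pow_mul, neg_one_sq, one_pow]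
    ring
  rw [← frobenius_def, map_gaussianInt f z, map_add, map_mul, map_intCast, map_intCast,
    frobenius_def, hIq, map_gaussianInt f (star z)]
  simp

end Reduction

section Reciprocity

variable {p q : ℕ} [Fact q.Prime] {K : Type*} [Field K] [CharP K q]
  {χ : MulChar (ZMod p) GaussianInt}

include q in
lemma ringHomComp_ne_one (hq : q ≠ 2) (f : GaussianInt →+* K) {ψ : MulChar (ZMod p) GaussianInt}
    (hψ : ψ ^ 4 = 1) (h : ψ ≠ 1) : ψ.ringHomComp f ≠ 1 := by
  contrapose! h
  ext a : 1
  rw [MulChar.one_apply_coe]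
  refine eq_one_of_map_eq_one hq f ?_ ?_
  · rw [← MulChar.pow_apply_coe, hψ, MulChar.one_apply_coe]
  · rw [← MulChar.ringHomComp_apply, h, MulChar.one_apply_coe]

variable [Fact p.Prime]

include q in
lemma gaussSum_mul_gaussSum_inv (hq : q ≠ 2) (f : GaussianInt →+* K) (hχ : orderOf χ = 4)
    {ψ : AddChar (ZMod p) K} (hψ : ψ.IsPrimitive) :
    gaussSum (χ.ringHomComp f) ψ * gaussSum (χ.ringHomComp f)⁻¹ ψ = f (χ (-1)) * p := by
  have h1 := gaussSum_mul_gaussSum_eq_card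
    (ringHomComp_ne_one hq f (quartic_pow_four hχ) (quartic_ne_one hχ)) hψ
  have h2 := mul_gaussSum_inv_eq_gaussSum (χ.ringHomComp f)⁻¹ ψ
  rw [MulChar.inv_apply', inv_neg_one, MulChar.ringHomComp_apply] at h2
  rw [ZMod.card] at h1
  rw [← h1, ← h2]
  ring

/-- The fourth power of the Gauss sum `g(χ)` of a quartic character, by way of
`g(χ) g(χ²) = J(χ, χ²) g(χ⁻¹)`, `g(χ) g(χ⁻¹) = χ(-1) p` and `g(χ²)² = p`. -/
lemma gaussSum_pow_four (hq : q ≠ 2) (hpq : p ≠ q) (f : GaussianInt →+* K) (hχ : orderOf χ = 4)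
    {ψ : AddChar (ZMod p) K} (hψ : ψ.IsPrimitive) :
    gaussSum (χ.ringHomComp f) ψ ^ 4
      = f (normalizedJacobi χ) ^ 3 * f (star (normalizedJacobi χ)) := by
  have hp0 : (p : K) ≠ 0 := by
    rw [Ne, CharP.cast_eq_zero_iff K q, Nat.prime_dvd_prime_iff_eq Fact.out Fact.out]
    exact hpq.symm
  have hχ2 : (χ.ringHomComp f) ^ 2 = (χ ^ 2).ringHomComp f := MulChar.ringHomComp_pow _ _ _
  have hinv : χ.ringHomComp f * (χ ^ 2).ringHomComp f = (χ.ringHomComp f)⁻¹ := by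
    rw [← MulChar.ringHomComp_mul, quartic_cube hχ, MulChar.ringHomComp_inv]
  have hε : f (χ (-1)) ^ 2 = 1 := by rw [← map_pow, quartic_neg_one_sq, map_one]
  have h1 := jacobiSum_mul_nontrivial (χ := χ.ringHomComp f) (φ := (χ ^ 2).ringHomComp f)
    (by
      rw [hinv]
      exact inv_ne_one.2 (ringHomComp_ne_one hq f (quartic_pow_four hχ) (quartic_ne_one hχ))) ψ
  rw [hinv, jacobiSum_ringHomComp] at h1
  have h2 := gaussSum_mul_gaussSum_inv hq f hχ hψ
  have h3 : gaussSum ((χ ^ 2).ringHomComp f) ψ ^ 2 = p := by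
    have := gaussSum_sq (χ := (χ ^ 2).ringHomComp f)
      (ringHomComp_ne_one hq f (by rw [← pow_mul, show 2 * 4 = 4 * 2 from rfl, pow_mul,
        quartic_pow_four hχ, one_pow]) (quartic_sq_ne_one hχ)) (fun a => by
        rw [MulChar.ringHomComp_apply]
        by_cases ha : a = 0
        · left; rw [ha, MulChar.map_zero, map_zero]
        right
        have h4 := quartic_apply_pow_four hχ ha
        rw [MulChar.pow_apply' χ two_ne_zero, map_pow]
        rw [← sq_eq_one_iff, ← pow_mul, ← map_pow, h4, map_one]) hψ
    rw [this, MulChar.ringHomComp_apply, MulChar.pow_apply' χ two_ne_zero, map_pow, hε,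
      one_mul, ZMod.card]
  have h4 : f (normalizedJacobi χ) * f (star (normalizedJacobi χ)) = p := by
    rw [← map_mul, normalizedJacobi_mul_star hχ, map_natCast]
  have h5 : f (normalizedJacobi χ) ^ 2 = f (jacobiSum χ (χ ^ 2)) ^ 2 := by
    rw [← map_pow, normalizedJacobi_sq, map_pow]
  set G := gaussSum (χ.ringHomComp f) ψ
  set G' := gaussSum (χ.ringHomComp f)⁻¹ ψ
  set G2 := gaussSum ((χ ^ 2).ringHomComp f) ψ
  set J := f (jacobiSum χ (χ ^ 2))
  have h6 : f (χ (-1)) * p * J = G ^ 2 * G2 := by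
    rw [← h2]; linear_combination G * h1
  have h7 : (p : K) * (G ^ 4) = p * (p * J ^ 2) := by
    calc (p : K) * G ^ 4 = (G ^ 2 * G2) ^ 2 := by rw [mul_pow, h3]; ring
      _ = p * (p * J ^ 2) := by rw [← h6, mul_pow, mul_pow, hε]; ring
  rw [mul_left_cancel₀ hp0 h7, ← h5, ← h4]
  ring

lemma exists_primitive_addChar [IsAlgClosed K] (hpq : p ≠ q) :
    ∃ ψ : AddChar (ZMod p) K, ψ.IsPrimitive := by
  have hp0 : (p : K) ≠ 0 := by
    rw [Ne, CharP.cast_eq_zero_iff K q, Nat.prime_dvd_prime_iff_eq Fact.out Fact.out]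
    exact hpq.symm
  have : NeZero (p : K) := ⟨hp0⟩
  obtain ⟨ζ, hζ⟩ := HasEnoughRootsOfUnity.exists_primitiveRoot K p
  exact ⟨_, AddChar.zmodChar_primitive_of_primitive_root p hζ⟩

lemma map_normalizedJacobi_ne_zero (hpq : p ≠ q) (f : GaussianInt →+* K) (hχ : orderOf χ = 4) :
    f (normalizedJacobi χ) ≠ 0 ∧ f (star (normalizedJacobi χ)) ≠ 0 := by
  have hp0 : (p : K) ≠ 0 := by
    rw [Ne, CharP.cast_eq_zero_iff K q, Nat.prime_dvd_prime_iff_eq Fact.out Fact.out]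
    exact hpq.symm
  have h4 : f (normalizedJacobi χ) * f (star (normalizedJacobi χ)) = p := by
    rw [← map_mul, normalizedJacobi_mul_star hχ, map_natCast]
  rw [← h4] at hp0
  exact ⟨left_ne_zero_of_mul hp0, right_ne_zero_of_mul hp0⟩

/-- Quartic reciprocity for a rational prime `q ≡ 1 (mod 4)`: apply Frobenius at `q` to the Gauss
sum of `χ` in characteristic `q`. -/
lemma quartic_reciprocity_of_one [IsAlgClosed K] (hq : q % 4 = 1) (hpq : p ≠ q)
    (f : GaussianInt →+* K) (hχ : orderOf χ = 4) :
    f (χ q) * f (star (normalizedJacobi χ)) ^ ((q - 1) / 4)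
      = f (normalizedJacobi χ) ^ ((q - 1) / 4) := by
  obtain ⟨ψ, hψ⟩ := exists_primitive_addChar (p := p) (K := K) hpq
  have hq2 : q ≠ 2 := by omega
  obtain ⟨m, hm⟩ : ∃ m, q = 4 * m + 1 := ⟨q / 4, by omega⟩
  have hqp : (q : ZMod p) ≠ 0 := by
    rw [Ne, ZMod.natCast_eq_zero_iff, Nat.prime_dvd_prime_iff_eq Fact.out Fact.out]
    exact hpq
  have hG4 := gaussSum_pow_four hq2 hpq f hχ hψ
  have hfr := gaussSum_frob q (χ.ringHomComp f) ψ
  have hsh := gaussSum_mulShift (χ.ringHomComp f) ψ (Ne.isUnit hqp).unit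
  have hχq : (χ.ringHomComp f) ^ q = χ.ringHomComp f := by
    rw [MulChar.ringHomComp_pow]
    conv_lhs => rw [hm, pow_succ, pow_mul, quartic_pow_four hχ, one_pow, one_mul]
  rw [hχq, AddChar.pow_mulShift] at hfr
  rw [IsUnit.unit_spec, ← hfr, MulChar.ringHomComp_apply] at hsh
  obtain ⟨hJ0, hJ0'⟩ := map_normalizedJacobi_ne_zero (χ := χ) hpq f hχ
  have hJq := map_pow_char_of_one hq f (normalizedJacobi χ)
  rw [show (q - 1) / 4 = m by omega]
  set G := gaussSum (χ.ringHomComp f) ψ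
  set J := f (normalizedJacobi χ)
  set J' := f (star (normalizedJacobi χ))
  have hG0 : G ≠ 0 := by
    intro h
    rw [h, zero_pow (by norm_num)] at hG4
    exact mul_ne_zero (pow_ne_zero 3 hJ0) hJ0' hG4.symm
  have h1 : f (χ q) * (J ^ 3 * J') ^ m = 1 := by
    refine mul_right_cancel₀ hG0 ?_
    rw [one_mul, ← hG4, ← pow_mul, mul_assoc, ← pow_succ, ← hm]
    exact hsh
  have h2 : J ^ (4 * m) = 1 := by
    refine mul_right_cancel₀ hJ0 ?_
    rw [one_mul, ← pow_succ, ← hm]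
    exact hJq
  calc f (χ q) * J' ^ m = f (χ q) * J' ^ m * J ^ (4 * m) := by rw [h2, mul_one]
    _ = f (χ q) * (J ^ 3 * J') ^ m * J ^ m := by
        rw [mul_pow, ← pow_mul, show 4 * m = 3 * m + m by ring, pow_add]; ring
    _ = J ^ m := by rw [h1, one_mul]

/-- Quartic reciprocity for a rational prime `q ≡ 3 (mod 4)`. Here Frobenius at `q` carries the
Gauss sum of `χ` to a multiple of that of `χ⁻¹`. -/
lemma quartic_reciprocity_of_three [IsAlgClosed K] (hq : q % 4 = 3) (hpq : p ≠ q)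
    (f : GaussianInt →+* K) (hχ : orderOf χ = 4) :
    f (χ (-q)) * f (normalizedJacobi χ) ^ ((q + 1) / 4)
      = f (star (normalizedJacobi χ)) ^ ((q + 1) / 4) := by
  obtain ⟨ψ, hψ⟩ := exists_primitive_addChar (p := p) (K := K) hpq
  have hq2 : q ≠ 2 := by omega
  obtain ⟨m, hm⟩ : ∃ m, q + 1 = 4 * m := ⟨(q + 1) / 4, by omega⟩
  have hqp : (q : ZMod p) ≠ 0 := by
    rw [Ne, ZMod.natCast_eq_zero_iff, Nat.prime_dvd_prime_iff_eq Fact.out Fact.out]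
    exact hpq
  have hG4 := gaussSum_pow_four hq2 hpq f hχ hψ
  have hfr := gaussSum_frob q (χ.ringHomComp f) ψ
  have hsh := gaussSum_mulShift_eq (χ.ringHomComp f)⁻¹ ψ (Ne.isUnit hqp).unit
  have hχq : (χ.ringHomComp f) ^ q = (χ.ringHomComp f)⁻¹ := by
    refine eq_inv_of_mul_eq_one_left ?_
    rw [← pow_succ, hm, MulChar.ringHomComp_pow, pow_mul, quartic_pow_four hχ, one_pow,
      MulChar.ringHomComp_one]
  rw [hχq, AddChar.pow_mulShift] at hfr
  rw [IsUnit.unit_spec, ← hfr, inv_inv, MulChar.ringHomComp_apply] at hsh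
  have hGG := gaussSum_mul_gaussSum_inv hq2 f hχ hψ
  obtain ⟨hJ0, hJ0'⟩ := map_normalizedJacobi_ne_zero (χ := χ) hpq f hχ
  have hJq := map_pow_char_of_three hq f (normalizedJacobi χ)
  have h4 : f (normalizedJacobi χ) * f (star (normalizedJacobi χ)) = p := by
    rw [← map_mul, normalizedJacobi_mul_star hχ, map_natCast]
  rw [show (q + 1) / 4 = m by omega, neg_eq_neg_one_mul (q : ZMod p), map_mul, map_mul]
  set G := gaussSum (χ.ringHomComp f) ψ
  set G' := gaussSum (χ.ringHomComp f)⁻¹ ψ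
  set J := f (normalizedJacobi χ)
  set J' := f (star (normalizedJacobi χ))
  have h1 : (J ^ 3 * J') ^ m = f (χ (-1)) * f (χ q) * (J * J') := by
    rw [← hG4, ← pow_mul, ← hm, pow_succ, hsh, h4]
    linear_combination f (χ q) * hGG
  have h2 : J * J' = J ^ (4 * m) := by rw [← hJq, ← hm, pow_succ']
  have h3 : J ^ (3 * m) ≠ 0 := pow_ne_zero _ hJ0
  refine mul_left_cancel₀ h3 ?_
  calc J ^ (3 * m) * (f (χ (-1)) * f (χ q) * J ^ m)
      = f (χ (-1)) * f (χ q) * J ^ (4 * m) := by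
        rw [show 4 * m = 3 * m + m by ring, pow_add]; ring
    _ = J ^ (3 * m) * J' ^ m := by rw [← h2, ← h1, mul_pow, ← pow_mul]

end Reciprocity

/-! ### The quartic symbol of a prime as a function of `x` modulo that prime -/

/-- `κ : ℕ → ℤ[i]` is a function of `x` modulo `q` which computes, for the primes `p = α² + x²`,
the value at `q* = ± q ≡ 1 (mod 4)` of the quartic character with Jacobi sum `α + x i`. It is
extended by zero to the `x` with `q ∣ x² + α²`, for which only `p = q` is possible. The moments are
those of a quartic character of the norm one group, of order `q* - 1` up to sign, with the
contribution of the point `-1` (that is, `x = ∞`) removed. -/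
structure IsLocalSymbol (q : ℕ) (α : ℤ) (κ : ℕ → GaussianInt) : Prop where
  periodic : Function.Periodic κ q
  eq_zero : ∀ x : ℕ, (q : ℤ) ∣ (x : ℤ) ^ 2 + α ^ 2 → κ x = 0
  pow_four : ∀ x : ℕ, ¬ (q : ℤ) ∣ (x : ℤ) ^ 2 + α ^ 2 → κ x ^ 4 = 1
  reciprocity : ∀ (p : ℕ) [Fact p.Prime] (χ : MulChar (ZMod p) GaussianInt), orderOf χ = 4 →
    p ≠ q → ∀ x : ℕ, normalizedJacobi χ = ⟨α, x⟩ → χ ((ZMod.χ₄ q * q : ℤ) : ZMod p) = κ x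
  sum_pow : ∀ k, 0 < k → k < 4 → ∑ x ∈ Finset.range q, κ x ^ k = -((-1) ^ ((q + 1) / 4)) ^ k
  sum_pow_four : ∑ x ∈ Finset.range q, κ x ^ 4 = (tauPrimePow q 1 : GaussianInt)

section Lift

variable {q : ℕ} [Fact q.Prime] {K : Type*} [Field K] [CharP K q]

open Classical in
/-- The inverse of a homomorphism `f : ℤ[i] → K` on the fourth roots of unity. -/
noncomputable def liftRoot (f : GaussianInt →+* K) (w : K) : GaussianInt :=
  if h : ∃ v : GaussianInt, v ^ 4 = 1 ∧ f v = w then h.choose else 0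

include q in
lemma liftRoot_map (hq : q ≠ 2) (f : GaussianInt →+* K) {v : GaussianInt} (hv : v ^ 4 = 1) :
    liftRoot f (f v) = v := by
  have h : ∃ v' : GaussianInt, v' ^ 4 = 1 ∧ f v' = f v := ⟨v, hv, rfl⟩
  rw [liftRoot, dif_pos h]
  exact eq_of_map_eq hq f h.choose_spec.1 hv h.choose_spec.2

lemma exists_map_eq (f : GaussianInt →+* K) {w : K} (hw : w ^ 4 = 1) :
    ∃ v : GaussianInt, v ^ 4 = 1 ∧ f v = w := by
  rcases fourth_root_cases (map_gaussI_sq f) hw with rfl | rfl | rfl | rfl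
  · exact ⟨1, by decide, map_one f⟩
  · exact ⟨-1, by decide, by rw [map_neg, map_one]⟩
  · exact ⟨gaussI, gaussI_isPrimitiveRoot.pow_eq_one, rfl⟩
  · exact ⟨-gaussI, by rw [neg_pow, gaussI_isPrimitiveRoot.pow_eq_one]; decide, map_neg _ _⟩

include q in
lemma liftRoot_spec (hq : q ≠ 2) (f : GaussianInt →+* K) {w : K} (hw : w ^ 4 = 1) :
    liftRoot f w ^ 4 = 1 ∧ f (liftRoot f w) = w := by
  obtain ⟨v, hv, rfl⟩ := exists_map_eq f hw
  rw [liftRoot_map hq f hv]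
  exact ⟨hv, rfl⟩

include q in
lemma liftRoot_mul (hq : q ≠ 2) (f : GaussianInt →+* K) {v w : K} (hv : v ^ 4 = 1)
    (hw : w ^ 4 = 1) : liftRoot f (v * w) = liftRoot f v * liftRoot f w := by
  obtain ⟨v, hv', rfl⟩ := exists_map_eq f hv
  obtain ⟨w, hw', rfl⟩ := exists_map_eq f hw
  rw [← map_mul, liftRoot_map hq f hv', liftRoot_map hq f hw',
    liftRoot_map hq f (by rw [mul_pow, hv', hw', one_mul])]

include q in
/-- A nontrivial power of the quartic symbol has mean zero over a group of roots of unity. -/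
lemma sum_liftRoot_nthRoots (hq : q ≠ 2) (f : GaussianInt →+* K) {m k : ℕ} (hm : 0 < m)
    {ζ : K} (hζ : IsPrimitiveRoot ζ (4 * m)) (hk : 0 < k) (hk4 : k < 4) :
    ∑ t ∈ Polynomial.nthRootsFinset (4 * m) (1 : K), liftRoot f (t ^ m) ^ k = 0 := by
  have hn : 0 < 4 * m := by omega
  have hroot : ∀ t ∈ Polynomial.nthRootsFinset (4 * m) (1 : K), (t ^ m) ^ 4 = 1 := by
    intro t ht
    rw [← pow_mul, mul_comm]
    exact (Polynomial.mem_nthRootsFinset hn _).1 ht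
  have hζ' : ζ ∈ Polynomial.nthRootsFinset (4 * m) (1 : K) :=
    (Polynomial.mem_nthRootsFinset hn _).2 hζ.pow_eq_one
  have hζ0 : ζ ≠ 0 := hζ.ne_zero (by omega)
  set c := liftRoot f (ζ ^ m) ^ k with hc
  have hc1 : c ≠ 1 := by
    intro h
    have h2 := congrArg f h
    rw [hc, map_pow, (liftRoot_spec hq f (hroot ζ hζ')).2, map_one, ← pow_mul] at h2
    have h3 := Nat.le_of_dvd (by positivity) ((hζ.pow_eq_one_iff_dvd _).1 h2)
    nlinarith
  -- multiplication by `ζ` permutes the roots of unity, so the sum is invariant under `c ≠ 1`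
  have hS : c * ∑ t ∈ Polynomial.nthRootsFinset (4 * m) (1 : K), liftRoot f (t ^ m) ^ k
      = ∑ t ∈ Polynomial.nthRootsFinset (4 * m) (1 : K), liftRoot f (t ^ m) ^ k := by
    rw [Finset.mul_sum]
    refine Finset.sum_bij' (fun t _ => ζ * t) (fun t _ => ζ⁻¹ * t) ?_ ?_ ?_ ?_ ?_
    · intro t ht
      rw [Polynomial.mem_nthRootsFinset hn] at ht ⊢
      rw [mul_pow, hζ.pow_eq_one, ht, one_mul]
    · intro t ht
      rw [Polynomial.mem_nthRootsFinset hn] at ht ⊢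
      rw [mul_pow, inv_pow, hζ.pow_eq_one, ht, inv_one, one_mul]
    · intro t _; exact inv_mul_cancel_left₀ hζ0 t
    · intro t _; exact mul_inv_cancel_left₀ hζ0 t
    · intro t ht
      rw [mul_pow, liftRoot_mul hq f (hroot ζ hζ') (hroot t ht), mul_pow, hc]
  have : (c - 1) * ∑ t ∈ Polynomial.nthRootsFinset (4 * m) (1 : K), liftRoot f (t ^ m) ^ k = 0 := by
    rw [sub_mul, hS, one_mul, sub_self]
  exact (mul_eq_zero.1 this).resolve_left (sub_ne_zero.2 hc1)

end Lift

section LocalSymbol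

variable {q : ℕ} [Fact q.Prime]


lemma chi_four_cases (hq : q ≠ 2) :
    (q % 4 = 1 ∧ ZMod.χ₄ q = 1 ∧ q = 4 * ((q + 1) / 4) + 1) ∨
      (q % 4 = 3 ∧ ZMod.χ₄ q = -1 ∧ q + 1 = 4 * ((q + 1) / 4)) := by
  have hodd : q % 2 = 1 := (Nat.Prime.eq_two_or_odd Fact.out).resolve_left hq
  rcases (show q % 4 = 1 ∨ q % 4 = 3 by omega) with h | h
  · exact Or.inl ⟨h, ZMod.χ₄_nat_one_mod_four h, by omega⟩
  · exact Or.inr ⟨h, ZMod.χ₄_nat_three_mod_four h, by omega⟩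

lemma chi_four_sq {K : Type*} [Field K] (hq : q ≠ 2) : (ZMod.χ₄ q : K) ^ 2 = 1 := by
  rcases chi_four_cases hq with ⟨_, h, _⟩ | ⟨_, h, _⟩ <;> rw [h] <;> simp

variable {K : Type*} [Field K] [CharP K q]

/-- The element `(α + s x i) / (α - s x i)` of the norm one group, where `s = (-1 / q)`. -/
noncomputable def normOne (f : GaussianInt →+* K) (α : ℤ) (x : ZMod q) : K :=
  f ⟨α, ZMod.χ₄ q * x.val⟩ / f ⟨α, -(ZMod.χ₄ q * x.val)⟩

lemma map_val (f : GaussianInt →+* K) (α s : ℤ) (x : ZMod q) :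
    f ⟨α, s * x.val⟩ = (α : K) + s * ZMod.castHom dvd_rfl K x * f gaussI := by
  rw [map_gaussianInt]
  push_cast
  rw [ZMod.castHom_apply, ZMod.natCast_val]

lemma normOne_eq (f : GaussianInt →+* K) (α : ℤ) (x : ZMod q) :
    normOne f α x = ((α : K) + ZMod.χ₄ q * ZMod.castHom dvd_rfl K x * f gaussI)
      / ((α : K) - ZMod.χ₄ q * ZMod.castHom dvd_rfl K x * f gaussI) := by
  rw [normOne, map_val, ← neg_mul, map_val]
  push_cast
  rw [neg_mul, neg_mul, ← sub_eq_add_neg]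

lemma norm_ne_zero (hq : q ≠ 2) (f : GaussianInt →+* K) (α : ℤ) {x : ZMod q}
    (hx : x ^ 2 + α ^ 2 ≠ 0) :
    (α : K) + ZMod.χ₄ q * ZMod.castHom dvd_rfl K x * f gaussI ≠ 0 ∧
      (α : K) - ZMod.χ₄ q * ZMod.castHom dvd_rfl K x * f gaussI ≠ 0 := by
  rw [← mul_ne_zero_iff]
  have h1 : ((α : K) + ZMod.χ₄ q * ZMod.castHom dvd_rfl K x * f gaussI) *
      ((α : K) - ZMod.χ₄ q * ZMod.castHom dvd_rfl K x * f gaussI)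
      = ZMod.castHom dvd_rfl K (x ^ 2 + α ^ 2) := by
    rw [map_add, map_pow, map_pow, map_intCast]
    linear_combination (-(ZMod.χ₄ q : K) ^ 2 * ZMod.castHom dvd_rfl K x ^ 2) * map_gaussI_sq f
      + ZMod.castHom dvd_rfl K x ^ 2 * chi_four_sq (K := K) hq
  rw [h1]
  exact (map_ne_zero_iff _ (ZMod.castHom dvd_rfl K).injective).2 hx

lemma normOne_pow (hq : q ≠ 2) (f : GaussianInt →+* K) (α : ℤ) {x : ZMod q}
    (hx : x ^ 2 + α ^ 2 ≠ 0) : normOne f α x ^ (4 * ((q + 1) / 4)) = 1 := by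
  obtain ⟨ha, hb⟩ := norm_ne_zero hq f α hx
  have hb' : f ⟨α, -(ZMod.χ₄ q * x.val)⟩ ≠ 0 := by
    rw [← neg_mul, map_val]; push_cast; rwa [neg_mul, neg_mul, ← sub_eq_add_neg]
  have ha' : f ⟨α, ZMod.χ₄ q * x.val⟩ ≠ 0 := by rwa [map_val]
  rcases chi_four_cases hq with ⟨h4, _, hm⟩ | ⟨h4, _, hm⟩
  · have h0 : normOne f α x ≠ 0 := div_ne_zero ha' hb'
    refine mul_right_cancel₀ h0 ?_
    rw [one_mul, ← pow_succ, ← hm, normOne, div_pow, map_pow_char_of_one h4,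
      map_pow_char_of_one h4]
  · rw [← hm, pow_succ, normOne, div_pow, map_pow_char_of_three h4, map_pow_char_of_three h4]
    have h1 : star (⟨α, ZMod.χ₄ q * x.val⟩ : GaussianInt) = ⟨α, -(ZMod.χ₄ q * x.val)⟩ := rfl
    have h2 : star (⟨α, -(ZMod.χ₄ q * x.val)⟩ : GaussianInt) = ⟨α, ZMod.χ₄ q * x.val⟩ := by
      rw [← h1, star_star]
    rw [h1, h2]
    field_simp

lemma normOne_ne_neg_one (hq : q ≠ 2) (f : GaussianInt →+* K) {α : ℤ} (hα : ¬ (q : ℤ) ∣ α)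
    {x : ZMod q} (hx : x ^ 2 + α ^ 2 ≠ 0) : normOne f α x ≠ -1 := by
  obtain ⟨ha, hb⟩ := norm_ne_zero hq f α hx
  have h2 := two_ne_zero_of_charP (K := K) hq
  have hα' : (α : K) ≠ 0 := by rwa [Ne, CharP.intCast_eq_zero_iff K q]
  rw [normOne_eq, Ne, div_eq_iff hb]
  intro h
  exact mul_ne_zero h2 hα' (by linear_combination h)

lemma normOne_injOn (hq : q ≠ 2) (f : GaussianInt →+* K) {α : ℤ} (hα : ¬ (q : ℤ) ∣ α)
    {x y : ZMod q} (hx : x ^ 2 + α ^ 2 ≠ 0) (hy : y ^ 2 + α ^ 2 ≠ 0)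
    (h : normOne f α x = normOne f α y) : x = y := by
  obtain ⟨ha, hb⟩ := norm_ne_zero hq f α hx
  obtain ⟨ha', hb'⟩ := norm_ne_zero hq f α hy
  have h2 := two_ne_zero_of_charP (K := K) hq
  have hα' : (α : K) ≠ 0 := by rwa [Ne, CharP.intCast_eq_zero_iff K q]
  have hI : f gaussI ≠ 0 := by
    intro h0; have := map_gaussI_sq f; rw [h0] at this; simp at this
  have hs : (ZMod.χ₄ q : K) ≠ 0 := by
    intro h0; have := chi_four_sq (K := K) hq; rw [h0] at this; simp at this
  rw [normOne_eq, normOne_eq, div_eq_div_iff hb hb'] at h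
  have h3 : (2 * α * f gaussI * ZMod.χ₄ q) *
      (ZMod.castHom dvd_rfl K x - ZMod.castHom dvd_rfl K y) = 0 := by
    linear_combination h
  have h4 := (mul_eq_zero.1 h3).resolve_left
    (mul_ne_zero (mul_ne_zero (mul_ne_zero h2 hα') hI) hs)
  exact (ZMod.castHom dvd_rfl K).injective (sub_eq_zero.1 h4)

lemma card_sum_sq_ne_zero (hq : q ≠ 2) {α : ℤ} (hα : ¬ (q : ℤ) ∣ α) :
    (Finset.univ.filter fun x : ZMod q => x ^ 2 + (α : ZMod q) ^ 2 ≠ 0).card + 1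
      = 4 * ((q + 1) / 4) := by
  have hα0 : (α : ZMod q) ≠ 0 := by rwa [Ne, ZMod.intCast_zmod_eq_zero_iff_dvd]
  have h1 := quadraticChar_card_sqrts (F := ZMod q) (by rw [ZMod.ringChar_zmod_n]; exact hq)
    (-(α : ZMod q) ^ 2)
  have h2 : quadraticChar (ZMod q) (-(α : ZMod q) ^ 2) = ZMod.χ₄ q := by
    rw [neg_eq_neg_one_mul, map_mul, quadraticChar_sq_one' hα0, mul_one,
      quadraticChar_neg_one (by rw [ZMod.ringChar_zmod_n]; exact hq), ZMod.card]
  have h3 : {x : ZMod q | x ^ 2 = -(α : ZMod q) ^ 2}.toFinset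
      = Finset.univ.filter fun x : ZMod q => x ^ 2 + (α : ZMod q) ^ 2 = 0 := by
    ext x; simp [eq_neg_iff_add_eq_zero]
  rw [h2, h3] at h1
  have h4 := Finset.card_filter_add_card_filter_not (s := (Finset.univ : Finset (ZMod q)))
    (fun x : ZMod q => x ^ 2 + (α : ZMod q) ^ 2 = 0)
  rw [Finset.card_univ, ZMod.card] at h4
  rcases chi_four_cases hq with ⟨_, h, hm⟩ | ⟨_, h, hm⟩ <;> rw [h] at h1 <;>
    simp only [Ne] <;> omega

/-- `x ↦ (α + s x i) / (α - s x i)` maps the admissible `x` bijectively onto the norm one group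
with `-1` removed. -/
lemma sum_normOne {M : Type*} [AddCommMonoid M] (hq : q ≠ 2) (f : GaussianInt →+* K) {α : ℤ}
    (hα : ¬ (q : ℤ) ∣ α) [DecidableEq K] {ζ : K} (hζ : IsPrimitiveRoot ζ (4 * ((q + 1) / 4)))
    (g : K → M) :
    ∑ x ∈ Finset.univ.filter (fun x : ZMod q => x ^ 2 + (α : ZMod q) ^ 2 ≠ 0), g (normOne f α x)
      = ∑ t ∈ (Polynomial.nthRootsFinset (4 * ((q + 1) / 4)) (1 : K)).erase (-1), g t := by
  set A := Finset.univ.filter (fun x : ZMod q => x ^ 2 + (α : ZMod q) ^ 2 ≠ 0) with hA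
  have hmem : ∀ x ∈ A, x ^ 2 + (α : ZMod q) ^ 2 ≠ 0 := fun x hx => (Finset.mem_filter.1 hx).2
  have hn : 0 < 4 * ((q + 1) / 4) := by
    have := chi_four_cases hq; have := (Fact.out : q.Prime).two_le; omega
  have hinj : Set.InjOn (normOne f α) (A : Set (ZMod q)) := fun x hx y hy h =>
    normOne_injOn hq f hα (hmem x hx) (hmem y hy) h
  have himg : A.image (normOne f α)
      = (Polynomial.nthRootsFinset (4 * ((q + 1) / 4)) (1 : K)).erase (-1) := by
    refine Finset.eq_of_subset_of_card_le ?_ ?_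
    · intro t ht
      obtain ⟨x, hx, rfl⟩ := Finset.mem_image.1 ht
      exact Finset.mem_erase.2 ⟨normOne_ne_neg_one hq f hα (hmem x hx),
        (Polynomial.mem_nthRootsFinset hn _).2 (normOne_pow hq f α (hmem x hx))⟩
    · have h1 : (-1 : K) ∈ Polynomial.nthRootsFinset (4 * ((q + 1) / 4)) (1 : K) := by
        rw [Polynomial.mem_nthRootsFinset hn, show 4 * ((q + 1) / 4) = 2 * (2 * ((q + 1) / 4)) by
          ring, pow_mul, neg_one_sq, one_pow]
      rw [Finset.card_erase_of_mem h1, hζ.card_nthRootsFinset, Finset.card_image_of_injOn hinj]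
      have h2 : A.card + 1 = 4 * ((q + 1) / 4) := card_sum_sq_ne_zero hq hα
      omega
  rw [← himg, Finset.sum_image hinj]

end LocalSymbol

lemma sum_range_natCast {M : Type*} [AddCommMonoid M] {n : ℕ} [NeZero n] (g : ZMod n → M) :
    ∑ x ∈ Finset.range n, g x = ∑ x, g x :=
  Finset.sum_nbij' (fun x : ℕ => (x : ZMod n)) ZMod.val (fun _ _ => Finset.mem_univ _)
    (fun x _ => Finset.mem_range.2 (ZMod.val_lt x))
    (fun _ hx => ZMod.val_cast_of_lt (Finset.mem_range.1 hx))
    (fun x _ => ZMod.natCast_zmod_val x) (fun _ _ => rfl)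

/-- Every odd prime `q ∤ α` has a local symbol. -/
theorem exists_isLocalSymbol {q : ℕ} (hqp : q.Prime) (hq : q ≠ 2) {α : ℤ} (hα : ¬ (q : ℤ) ∣ α) :
    ∃ κ : ℕ → GaussianInt, IsLocalSymbol q α κ := by
  have : Fact q.Prime := ⟨hqp⟩
  classical
  obtain ⟨j, hj⟩ := IsAlgClosed.exists_pow_nat_eq (-1 : AlgebraicClosure (ZMod q)) two_pos
  let f : GaussianInt →+* AlgebraicClosure (ZMod q) := Zsqrtd.lift ⟨j, by rw [← sq, hj]; simp⟩
  have hc := chi_four_cases hq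
  have hm : 0 < (q + 1) / 4 := by have := hqp.two_le; omega
  have hn : ((4 * ((q + 1) / 4) : ℕ) : AlgebraicClosure (ZMod q)) ≠ 0 := by
    rw [Ne, CharP.cast_eq_zero_iff _ q]
    intro h
    have h1 := Nat.le_of_dvd (by omega) h
    rcases hc with ⟨_, _, h⟩ | ⟨_, _, h'⟩
    · omega
    · rw [← h', Nat.dvd_add_right dvd_rfl] at h
      exact hqp.one_lt.ne' (Nat.dvd_one.1 h)
  have : NeZero ((4 * ((q + 1) / 4) : ℕ) : AlgebraicClosure (ZMod q)) := ⟨hn⟩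
  obtain ⟨ζ, hζ⟩ := HasEnoughRootsOfUnity.exists_primitiveRoot
    (AlgebraicClosure (ZMod q)) (4 * ((q + 1) / 4))
  set A := Finset.univ.filter (fun x : ZMod q => x ^ 2 + (α : ZMod q) ^ 2 ≠ 0) with hA
  let κ : ZMod q → GaussianInt := fun x =>
    if x ^ 2 + (α : ZMod q) ^ 2 ≠ 0 then liftRoot f (normOne f α x ^ ((q + 1) / 4)) else 0
  have hκ4 : ∀ x : ZMod q, x ^ 2 + (α : ZMod q) ^ 2 ≠ 0 → κ x ^ 4 = 1 := by
    intro x hx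
    simp only [κ, if_pos hx]
    exact (liftRoot_spec hq f (by rw [← pow_mul, mul_comm]; exact normOne_pow hq f α hx)).1
  have hsumA : ∀ k, 0 < k → ∑ x ∈ Finset.range q, κ x ^ k = ∑ x ∈ A, κ x ^ k := by
    intro k hk
    rw [sum_range_natCast (fun x => κ x ^ k), hA, Finset.sum_filter]
    refine Finset.sum_congr rfl fun x _ => ?_
    by_cases hx : x ^ 2 + (α : ZMod q) ^ 2 ≠ 0
    · rw [if_pos hx]
    · simp only [κ, if_neg hx]; rw [zero_pow hk.ne']
  have hdvd : ∀ x : ℕ, (q : ℤ) ∣ (x : ℤ) ^ 2 + α ^ 2 ↔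
      (x : ZMod q) ^ 2 + (α : ZMod q) ^ 2 = 0 := fun x => by
    rw [← ZMod.intCast_zmod_eq_zero_iff_dvd]; push_cast; rfl
  refine ⟨fun x => κ x, ⟨fun x => ?_, fun x hx => ?_, fun x hx => hκ4 x ((hdvd x).not.1 hx),
    ?_, ?_, ?_⟩⟩
  · simp
  · simp only [κ, ne_eq, (hdvd x).1 hx, not_true_eq_false, if_false]
  · intro p hp χ hχ hpq x hJ
    have hne := map_normalizedJacobi_ne_zero (χ := χ) hpq f hχ
    have hx : ((x : ZMod q)) ^ 2 + (α : ZMod q) ^ 2 ≠ 0 := by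
      have h1 := normalizedJacobi_mul_star hχ
      rw [hJ] at h1
      have h2 := congrArg Zsqrtd.re h1
      simp at h2
      intro h0
      have h3 : ((p : ℤ) : ZMod q) = 0 := by
        rw [← h2]; push_cast; linear_combination h0
      rw [ZMod.intCast_zmod_eq_zero_iff_dvd, Int.natCast_dvd_natCast,
        Nat.prime_dvd_prime_iff_eq hqp hp.out] at h3
      exact hpq h3.symm
    have hval : ∀ s : ℤ, f ⟨α, s * (x : ZMod q).val⟩ = f ⟨α, s * (x : ℤ)⟩ := by
      intro s
      rw [map_val, map_gaussianInt f ⟨α, s * (x : ℤ)⟩, map_natCast]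
      push_cast; rfl
    have h4 : χ ((ZMod.χ₄ q * q : ℤ) : ZMod p) ^ 4 = 1 := by
      refine quartic_apply_pow_four hχ ?_
      have hqp0 : (q : ZMod p) ≠ 0 := by
        rw [Ne, ZMod.natCast_eq_zero_iff, Nat.prime_dvd_prime_iff_eq hp.out hqp]
        exact hpq
      rcases hc with ⟨_, h, _⟩ | ⟨_, h, _⟩ <;> rw [h] <;> simpa using hqp0
    have hkey : f (χ ((ZMod.χ₄ q * q : ℤ) : ZMod p))
        = normOne f α (x : ZMod q) ^ ((q + 1) / 4) := by
      have hstar : star (⟨α, (x : ℤ)⟩ : GaussianInt) = ⟨α, -(x : ℤ)⟩ := rfl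
      rw [normOne, hval, ← neg_mul, hval, div_pow]
      rw [hJ, hstar] at hne
      rcases hc with ⟨h4, h, hm⟩ | ⟨h4, h, hm⟩
      · have := quartic_reciprocity_of_one (K := AlgebraicClosure (ZMod q)) h4 hpq f hχ
        rw [hJ, hstar, show (q - 1) / 4 = (q + 1) / 4 by omega] at this
        rw [h]
        simp only [one_mul, neg_mul, Int.cast_natCast]
        rw [eq_div_iff (pow_ne_zero _ hne.2)]
        exact this
      · have := quartic_reciprocity_of_three (K := AlgebraicClosure (ZMod q)) h4 hpq f hχ
        rw [hJ, hstar] at this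
        rw [h]
        simp only [one_mul, neg_mul, neg_neg, Int.cast_neg, Int.cast_natCast]
        rw [eq_div_iff (pow_ne_zero _ hne.1)]
        exact this
    simp only [κ]
    rw [if_pos hx, ← hkey, liftRoot_map hq f h4]
  · intro k hk hk4
    rw [hsumA k hk]
    have h1 : ∑ x ∈ A, κ x ^ k
        = ∑ x ∈ A, (fun t => liftRoot f (t ^ ((q + 1) / 4)) ^ k) (normOne f α x) := by
      refine Finset.sum_congr rfl fun x hx => ?_
      simp only [κ, if_pos (Finset.mem_filter.1 hx).2]
    have hn0 : 0 < 4 * ((q + 1) / 4) := by omega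
    have h2 : (-1 : AlgebraicClosure (ZMod q)) ∈
        Polynomial.nthRootsFinset (4 * ((q + 1) / 4)) (1 : AlgebraicClosure (ZMod q)) := by
      rw [Polynomial.mem_nthRootsFinset hn0,
        show 4 * ((q + 1) / 4) = 2 * (2 * ((q + 1) / 4)) by ring, pow_mul, neg_one_sq, one_pow]
    have h3 : liftRoot f ((-1) ^ ((q + 1) / 4)) = (-1) ^ ((q + 1) / 4) := by
      have := liftRoot_map hq f (v := (-1) ^ ((q + 1) / 4))
        (by rw [← pow_mul, mul_comm, pow_mul]; norm_num)
      rwa [map_pow, map_neg, map_one] at this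
    have h4 := sum_normOne hq f hα hζ (fun t => liftRoot f (t ^ ((q + 1) / 4)) ^ k)
    rw [← hA] at h4
    have h5 := Finset.sum_erase_add _ (fun t => liftRoot f (t ^ ((q + 1) / 4)) ^ k) h2
    rw [sum_liftRoot_nthRoots hq f hm hζ hk hk4, h3] at h5
    rw [h1, h4]
    exact eq_neg_of_add_eq_zero_left h5
  · rw [hsumA 4 (by norm_num), Finset.sum_congr rfl (g := fun _ => (1 : GaussianInt))
      (fun x hx => hκ4 x (Finset.mem_filter.1 hx).2), Finset.sum_const, nsmul_eq_mul, mul_one]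
    have h1 : A.card + 1 = 4 * ((q + 1) / 4) := card_sum_sq_ne_zero hq hα
    have h5 : A.card = tauPrimePow q 1 := by
      rw [tauPrimePow]
      rcases hc with ⟨h4, _, h⟩ | ⟨h4, _, h⟩
      · rw [if_pos h4, Nat.sub_self, pow_zero, one_mul]; omega
      · rw [if_neg (by omega), pow_one]; omega
    rw [h5]

/-! ### Sums over a complete residue system -/

lemma sum_range_mul_of_coprime {R : Type*} [CommSemiring R] {m n : ℕ} (hm : 0 < m) (hn : 0 < n)
    (hmn : m.Coprime n) {F G : ℕ → R} (hF : Function.Periodic F m) (hG : Function.Periodic G n) :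
    ∑ x ∈ Finset.range (m * n), F x * G x
      = (∑ x ∈ Finset.range m, F x) * ∑ x ∈ Finset.range n, G x := by
  rw [Finset.sum_mul_sum, ← Finset.sum_product']
  refine Finset.sum_bij' (fun x _ => (x % m, x % n))
    (fun z _ => (Nat.chineseRemainder hmn z.1 z.2 : ℕ)) ?_ ?_ ?_ ?_ ?_
  · intro x _
    exact Finset.mem_product.2
      ⟨Finset.mem_range.2 (Nat.mod_lt _ hm), Finset.mem_range.2 (Nat.mod_lt _ hn)⟩
  · intro z _
    exact Finset.mem_range.2 (Nat.chineseRemainder_lt_mul hmn _ _ hm.ne' hn.ne')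
  · intro x hx
    have h1 := (Nat.chineseRemainder hmn (x % m) (x % n)).2
    refine Nat.ModEq.eq_of_lt_of_lt ((Nat.modEq_and_modEq_iff_modEq_mul hmn).1
      ⟨h1.1.trans (Nat.mod_modEq _ _), h1.2.trans (Nat.mod_modEq _ _)⟩)
      (Nat.chineseRemainder_lt_mul hmn _ _ hm.ne' hn.ne') (Finset.mem_range.1 hx)
  · intro z hz
    have h1 := (Nat.chineseRemainder hmn z.1 z.2).2
    obtain ⟨ha, hb⟩ := Finset.mem_product.1 hz
    exact Prod.ext (Eq.trans h1.1 (Nat.mod_eq_of_lt (Finset.mem_range.1 ha)))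
      (Eq.trans h1.2 (Nat.mod_eq_of_lt (Finset.mem_range.1 hb)))
  · intro x _
    simp only [hF.map_mod_nat, hG.map_mod_nat]

lemma periodic_of_dvd {R : Type*} {F : ℕ → R} {m n : ℕ} (hF : Function.Periodic F m)
    (h : m ∣ n) : Function.Periodic F n := by
  obtain ⟨k, rfl⟩ := h
  rw [mul_comm]
  exact hF.nat_mul k

lemma periodic_prod {R : Type*} [CommSemiring R] {S : Finset ℕ} {F : ℕ → ℕ → R}
    (hF : ∀ q ∈ S, Function.Periodic (F q) q) :
    Function.Periodic (fun x => ∏ q ∈ S, F q x) (∏ q ∈ S, q) := fun x =>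
  Finset.prod_congr rfl fun q hq => periodic_of_dvd (hF q hq) (Finset.dvd_prod_of_mem _ hq) x

lemma sum_range_mul_prod {R : Type*} [CommSemiring R] {S : Finset ℕ} (hS : ∀ q ∈ S, q.Prime)
    {m : ℕ} (hm : 0 < m) (hmS : ∀ q ∈ S, m.Coprime q) {s : ℕ → R} (hs : Function.Periodic s m)
    {F : ℕ → ℕ → R} (hF : ∀ q ∈ S, Function.Periodic (F q) q) :
    ∑ x ∈ Finset.range (m * ∏ q ∈ S, q), s x * ∏ q ∈ S, F q x
      = (∑ x ∈ Finset.range m, s x) * ∏ q ∈ S, ∑ x ∈ Finset.range q, F q x := by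
  classical
  induction S using Finset.induction_on with
  | empty => simp
  | insert a S ha ih =>
    have hS' : ∀ q ∈ S, q.Prime := fun q hq => hS q (Finset.mem_insert_of_mem hq)
    have hF' : ∀ q ∈ S, Function.Periodic (F q) q := fun q hq => hF q (Finset.mem_insert_of_mem hq)
    have hmS' : ∀ q ∈ S, m.Coprime q := fun q hq => hmS q (Finset.mem_insert_of_mem hq)
    have haS := Finset.mem_insert_self a S
    rw [Finset.prod_insert ha, Finset.prod_insert ha,
      show m * (a * ∏ q ∈ S, q) = (m * ∏ q ∈ S, q) * a by ring]
    have hpos : 0 < ∏ q ∈ S, q := Finset.prod_pos fun q hq => (hS' q hq).pos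
    have hcop : (m * ∏ q ∈ S, q).Coprime a := by
      refine Nat.Coprime.mul_left (hmS a haS) (Nat.Coprime.prod_left fun q hq => ?_)
      exact (Nat.coprime_primes (hS' q hq) (hS a haS)).2 (by rintro rfl; exact ha hq)
    have hper : Function.Periodic (fun x => s x * ∏ q ∈ S, F q x) (m * ∏ q ∈ S, q) := fun x => by
      have h3 := periodic_of_dvd hs (Dvd.intro (∏ q ∈ S, q) rfl) x
      have h4 := periodic_of_dvd (periodic_prod hF') (Dvd.intro_left m rfl) x
      simp only at h3 h4 ⊢
      rw [h3, h4]
    have := sum_range_mul_of_coprime (Nat.mul_pos hm hpos) (hS a haS).pos hcop hper (hF a haS)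
    rw [ih hS' hmS' hF'] at this
    calc _ = ∑ x ∈ Finset.range ((m * ∏ q ∈ S, q) * a), (s x * ∏ q ∈ S, F q x) * F a x :=
          Finset.sum_congr rfl fun x _ => by rw [Finset.prod_insert ha]; ring
      _ = _ := by rw [this]; ring

/-! ### The value distribution of the global symbol -/

/-- Counting values by means of the first four moments: for `w` zero or a fourth root of unity,
`w⁴ + w³ + w² + w` is `4` if `w = 1` and `0` otherwise. -/
lemma four_mul_card_filter {A : Finset ℕ} {W : ℕ → GaussianInt}
    (hW : ∀ x ∈ A, W x = 0 ∨ W x ^ 4 = 1) :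
    4 * ((A.filter fun x => W x = 1).card : GaussianInt)
        = ∑ x ∈ A, W x ^ 4 + ∑ x ∈ A, W x ^ 2 + (∑ x ∈ A, W x + ∑ x ∈ A, W x ^ 3) ∧
      4 * ((A.filter fun x => W x = -1).card : GaussianInt)
        = ∑ x ∈ A, W x ^ 4 + ∑ x ∈ A, W x ^ 2 - (∑ x ∈ A, W x + ∑ x ∈ A, W x ^ 3) ∧
      ((A.filter fun x => W x ≠ 0).card : GaussianInt) = ∑ x ∈ A, W x ^ 4 := by
  have h : ∀ w : GaussianInt, w = 0 ∨ w ^ 4 = 1 →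
      (4 * (if w = 1 then (1 : GaussianInt) else 0) = w ^ 4 + w ^ 2 + (w + w ^ 3)) ∧
      (4 * (if w = -1 then (1 : GaussianInt) else 0) = w ^ 4 + w ^ 2 - (w + w ^ 3)) ∧
      (if w ≠ 0 then (1 : GaussianInt) else 0) = w ^ 4 := by
    rintro w (rfl | hw)
    · decide
    · rcases fourth_root_cases gaussI_sq hw with rfl | rfl | rfl | rfl <;>
        simp only [pow_succ, pow_zero, one_mul] <;> decide
  simp only [Finset.card_filter, Nat.cast_sum, Finset.mul_sum, ← Finset.sum_add_distrib,
    ← Finset.sum_sub_distrib]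
  refine ⟨Finset.sum_congr rfl fun x hx => ?_, Finset.sum_congr rfl fun x hx => ?_,
    Finset.sum_congr rfl fun x hx => ?_⟩
  · rw [← (h _ (hW x hx)).1]; split_ifs <;> simp
  · rw [← (h _ (hW x hx)).2.1]; split_ifs <;> simp
  · rw [← (h _ (hW x hx)).2.2]; split_ifs <;> simp

/-- The contribution of the prime `2`: the value of the quartic character at `±1`, as a function of
`x` modulo `4`. -/
def twoSymbol (δ : GaussianInt) (x : ℕ) : GaussianInt :=
  if x % 4 = 0 then 1 else if x % 4 = 2 then δ else 0

lemma twoSymbol_periodic (δ : GaussianInt) : Function.Periodic (twoSymbol δ) 4 := fun x => by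
  simp [twoSymbol]

/-- The value of the quartic character with Jacobi sum `α + x i` at `D`, as a function of `x`; here
`δ = ± 1` is the sign with `δ ≡ D (mod 4)`. It vanishes at the inadmissible `x`. -/
def globalSymbol (δ : GaussianInt) (κ : ℕ → ℕ → GaussianInt) (P Q L : Finset ℕ) (x : ℕ) :
    GaussianInt :=
  twoSymbol δ x * (∏ q ∈ P, κ q x) * (∏ q ∈ Q, κ q x ^ 2) * ∏ q ∈ L, κ q x ^ 3

/-- The modulus of the global symbol. -/
def modulus (P Q L : Finset ℕ) : ℕ := 4 * (∏ q ∈ P, q) * (∏ q ∈ Q, q) * ∏ q ∈ L, q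

section GlobalSymbol

variable {P Q L : Finset ℕ} {κ : ℕ → ℕ → GaussianInt} {α : ℤ}

/-- The moments of the global symbol factor into local ones, by the Chinese remainder theorem. -/
lemma sum_globalSymbol_pow (hP : ∀ l ∈ P, l.Prime ∧ Odd l) (hQ : ∀ l ∈ Q, l.Prime ∧ Odd l)
    (hL : ∀ l ∈ L, l.Prime ∧ Odd l) (hPQ : Disjoint P Q) (hPL : Disjoint P L) (hQL : Disjoint Q L)
    (hκ : ∀ q, q ∈ P ∨ q ∈ Q ∨ q ∈ L → IsLocalSymbol q α (κ q)) (δ : GaussianInt) (k : ℕ) :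
    ∑ x ∈ Finset.range (modulus P Q L), globalSymbol δ κ P Q L x ^ k
      = (∑ x ∈ Finset.range 4, twoSymbol δ x ^ k)
        * (∏ q ∈ P, ∑ x ∈ Finset.range q, κ q x ^ k)
        * (∏ q ∈ Q, ∑ x ∈ Finset.range q, κ q x ^ (2 * k))
        * ∏ q ∈ L, ∑ x ∈ Finset.range q, κ q x ^ (3 * k) := by
  have hper : ∀ q, q ∈ P ∨ q ∈ Q ∨ q ∈ L → ∀ j, Function.Periodic (fun x => κ q x ^ j) q :=
    fun q hq j x => by simp only; rw [(hκ q hq).periodic x]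
  have h2 : Function.Periodic (fun x => twoSymbol δ x ^ k) 4 := fun x => by
    simp only; rw [twoSymbol_periodic δ x]
  have hodd : ∀ q, Odd q → Nat.Coprime 4 q := fun q hq =>
    Nat.Coprime.pow_left 2 (Nat.coprime_two_left.2 hq)
  have hPQc : ∀ q ∈ Q, (∏ p ∈ P, p).Coprime q := fun q hq => Nat.Coprime.prod_left fun p hp =>
    (Nat.coprime_primes (hP p hp).1 (hQ q hq).1).2
      (by rintro rfl; exact Finset.disjoint_left.1 hPQ hp hq)
  have hPLc : ∀ q ∈ L, (∏ p ∈ P, p).Coprime q := fun q hq => Nat.Coprime.prod_left fun p hp =>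
    (Nat.coprime_primes (hP p hp).1 (hL q hq).1).2
      (by rintro rfl; exact Finset.disjoint_left.1 hPL hp hq)
  have hQLc : ∀ q ∈ L, (∏ p ∈ Q, p).Coprime q := fun q hq => Nat.Coprime.prod_left fun p hp =>
    (Nat.coprime_primes (hQ p hp).1 (hL q hq).1).2
      (by rintro rfl; exact Finset.disjoint_left.1 hQL hp hq)
  have hPpos : 0 < ∏ p ∈ P, p := Finset.prod_pos fun q hq => (hP q hq).1.pos
  have hQpos : 0 < ∏ p ∈ Q, p := Finset.prod_pos fun q hq => (hQ q hq).1.pos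
  have hperP : Function.Periodic (fun x => twoSymbol δ x ^ k * ∏ q ∈ P, κ q x ^ k)
      (4 * ∏ q ∈ P, q) := fun x => by
    have h3 := periodic_of_dvd h2 (Dvd.intro (∏ q ∈ P, q) rfl) x
    have h4 := periodic_of_dvd (periodic_prod fun q hq => hper q (Or.inl hq) k)
      (Dvd.intro_left 4 rfl) x
    simp only at h3 h4 ⊢
    rw [h3, h4]
  have hperQ : Function.Periodic (fun x => (twoSymbol δ x ^ k * ∏ q ∈ P, κ q x ^ k)
      * ∏ q ∈ Q, κ q x ^ (2 * k)) ((4 * ∏ q ∈ P, q) * ∏ q ∈ Q, q) := fun x => by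
    have h3 := periodic_of_dvd hperP (Dvd.intro (∏ q ∈ Q, q) rfl) x
    have h4 := periodic_of_dvd (periodic_prod fun q hq => hper q (Or.inr (Or.inl hq)) (2 * k))
      (Dvd.intro_left (4 * ∏ q ∈ P, q) rfl) x
    simp only at h3 h4 ⊢
    rw [h3, h4]
  rw [← sum_range_mul_prod (fun q hq => (hP q hq).1) (by norm_num)
      (fun q hq => hodd q (hP q hq).2) h2 (fun q hq => hper q (Or.inl hq) k),
    ← sum_range_mul_prod (fun q hq => (hQ q hq).1) (by positivity)
      (fun q hq => (hodd q (hQ q hq).2).mul_left (hPQc q hq)) hperP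
      (fun q hq => hper q (Or.inr (Or.inl hq)) (2 * k)),
    ← sum_range_mul_prod (fun q hq => (hL q hq).1) (by positivity)
      (fun q hq => ((hodd q (hL q hq).2).mul_left (hPLc q hq)).mul_left (hQLc q hq)) hperQ
      (fun q hq => hper q (Or.inr (Or.inr hq)) (3 * k))]
  refine Finset.sum_congr rfl fun x _ => ?_
  simp only [globalSymbol, mul_pow, ← Finset.prod_pow, ← pow_mul]

lemma globalSymbol_cases (hκ : ∀ q, q ∈ P ∨ q ∈ Q ∨ q ∈ L → IsLocalSymbol q α (κ q))
    {δ : GaussianInt} (hδ : δ ^ 2 = 1) (x : ℕ) :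
    (globalSymbol δ κ P Q L x = 0 ∧
        (x % 2 = 1 ∨ ∃ q, (q ∈ P ∨ q ∈ Q ∨ q ∈ L) ∧ (q : ℤ) ∣ (x : ℤ) ^ 2 + α ^ 2)) ∨
      (globalSymbol δ κ P Q L x ^ 4 = 1 ∧
        x % 2 = 0 ∧ ∀ q, q ∈ P ∨ q ∈ Q ∨ q ∈ L → ¬ (q : ℤ) ∣ (x : ℤ) ^ 2 + α ^ 2) := by
  by_cases hx : x % 2 = 1
  · left
    refine ⟨?_, Or.inl hx⟩
    rw [globalSymbol, twoSymbol, if_neg (by omega), if_neg (by omega)]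
    simp only [zero_mul]
  by_cases hq : ∃ q, (q ∈ P ∨ q ∈ Q ∨ q ∈ L) ∧ (q : ℤ) ∣ (x : ℤ) ^ 2 + α ^ 2
  · left
    refine ⟨?_, Or.inr hq⟩
    obtain ⟨q, hq, hdvd⟩ := hq
    have h0 := (hκ q hq).eq_zero x hdvd
    rw [globalSymbol]
    rcases hq with hq | hq | hq
    · rw [Finset.prod_eq_zero hq h0]; ring
    · rw [Finset.prod_eq_zero hq (by rw [h0]; ring)]; ring
    · rw [Finset.prod_eq_zero hq (by rw [h0]; ring)]; ring
  · right
    push Not at hq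
    refine ⟨?_, by omega, hq⟩
    have h4 : ∀ q, q ∈ P ∨ q ∈ Q ∨ q ∈ L → κ q x ^ 4 = 1 := fun q h =>
      (hκ q h).pow_four x (hq q h)
    have h5 : twoSymbol δ x ^ 4 = 1 := by
      have : δ ^ 4 = 1 := by rw [show 4 = 2 * 2 from rfl, pow_mul, hδ, one_pow]
      rw [twoSymbol]
      split_ifs
      · rw [one_pow]
      · exact this
      · omega
    rw [globalSymbol, mul_pow, mul_pow, mul_pow, h5, ← Finset.prod_pow, ← Finset.prod_pow,
      ← Finset.prod_pow, Finset.prod_eq_one fun q h => h4 q (Or.inl h),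
      Finset.prod_eq_one fun q h => by rw [← pow_mul, mul_comm, pow_mul, h4 q (Or.inr (Or.inl h)),
        one_pow],
      Finset.prod_eq_one fun q h => by rw [← pow_mul, mul_comm, pow_mul, h4 q (Or.inr (Or.inr h)),
        one_pow]]
    norm_num

end GlobalSymbol

/-- The higher moments of a local symbol reduce to the first four. -/
lemma IsLocalSymbol.sum_pow_add_four {q : ℕ} {α : ℤ} {κ : ℕ → GaussianInt}
    (hκ : IsLocalSymbol q α κ) {k : ℕ} (hk : 0 < k) :
    ∑ x ∈ Finset.range q, κ x ^ (k + 4) = ∑ x ∈ Finset.range q, κ x ^ k := by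
  refine Finset.sum_congr rfl fun x _ => ?_
  by_cases h : (q : ℤ) ∣ (x : ℤ) ^ 2 + α ^ 2
  · rw [hκ.eq_zero x h, zero_pow hk.ne', zero_pow (by omega)]
  · rw [pow_add, hκ.pow_four x h, mul_one]

lemma sum_twoSymbol_pow (δ : GaussianInt) {k : ℕ} (hk : 0 < k) :
    ∑ x ∈ Finset.range 4, twoSymbol δ x ^ k = 1 + δ ^ k := by
  simp [Finset.sum_range_succ, twoSymbol, zero_pow hk.ne']

/-- The sign `-(-1) ^ ((q + 1) / 4)` is `-1` exactly for `q ≡ ± 1 (mod 8)`. -/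
lemma prod_neg_sign {S : Finset ℕ} (hS : ∀ l ∈ S, l.Prime ∧ Odd l) :
    ∏ q ∈ S, (-((-1) ^ ((q + 1) / 4)) : GaussianInt) = (-1) ^ (countMod8 S 1 + countMod8 S 7) := by
  rw [pow_add, countMod8, countMod8, ← Finset.prod_const, ← Finset.prod_const,
    Finset.prod_filter, Finset.prod_filter, ← Finset.prod_mul_distrib]
  refine Finset.prod_congr rfl fun q hq => ?_
  have hodd := Nat.odd_iff.1 (hS q hq).2
  rcases (show q % 8 = 1 ∨ q % 8 = 3 ∨ q % 8 = 5 ∨ q % 8 = 7 by omega) with h | h | h | h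
  · rw [Even.neg_one_pow (by rw [Nat.even_iff]; omega), h]; norm_num
  · rw [Odd.neg_one_pow (by rw [Nat.odd_iff]; omega), h]; norm_num
  · rw [Odd.neg_one_pow (by rw [Nat.odd_iff]; omega), h]; norm_num
  · rw [Even.neg_one_pow (by rw [Nat.even_iff]; omega), h]; norm_num

lemma neg_one_pow_sq (m : ℕ) : ((-1 : GaussianInt) ^ m) ^ 2 = 1 := by
  rw [← pow_mul, mul_comm, pow_mul, neg_one_sq, one_pow]

section Moments

variable {P Q L : Finset ℕ} {κ : ℕ → ℕ → GaussianInt} {α : ℤ}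

/-- The first four moments of the global symbol. For the primes in `Q`, whose local symbol enters
squared, the second moment is already the trivial one. -/
lemma globalSymbol_moments (hP : ∀ l ∈ P, l.Prime ∧ Odd l) (hQ : ∀ l ∈ Q, l.Prime ∧ Odd l)
    (hL : ∀ l ∈ L, l.Prime ∧ Odd l) (hPQ : Disjoint P Q) (hPL : Disjoint P L) (hQL : Disjoint Q L)
    (hκ : ∀ q, q ∈ P ∨ q ∈ Q ∨ q ∈ L → IsLocalSymbol q α (κ q)) {δ : GaussianInt}
    (hδ : δ ^ 2 = 1) :
    (∑ x ∈ Finset.range (modulus P Q L), globalSymbol δ κ P Q L x ^ 4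
        = 2 * (∏ q ∈ P, (tauPrimePow q 1 : GaussianInt)) * (∏ q ∈ Q, (tauPrimePow q 1 : GaussianInt))
          * ∏ q ∈ L, (tauPrimePow q 1 : GaussianInt)) ∧
      (∑ x ∈ Finset.range (modulus P Q L), globalSymbol δ κ P Q L x ^ 2
        = 2 * (-1) ^ (P.card + L.card) * ∏ q ∈ Q, (tauPrimePow q 1 : GaussianInt)) ∧
      (∑ x ∈ Finset.range (modulus P Q L), globalSymbol δ κ P Q L x
          + ∑ x ∈ Finset.range (modulus P Q L), globalSymbol δ κ P Q L x ^ 3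
        = 2 * (1 + δ) * (-1) ^ (countMod8 P 1 + countMod8 P 7 + Q.card
            + countMod8 L 1 + countMod8 L 7)) := by
  have hsum := sum_globalSymbol_pow hP hQ hL hPQ hPL hQL hκ δ
  have hδ3 : δ ^ 3 = δ := by rw [pow_succ, hδ, one_mul]
  have hδ4 : δ ^ 4 = 1 := by rw [show 4 = 2 * 2 from rfl, pow_mul, hδ, one_pow]
  have hcube : ∀ m : ℕ, (-((-1 : GaussianInt) ^ m) ^ 3) = -(-1) ^ m := fun m => by
    rw [pow_succ, neg_one_pow_sq, one_mul]
  have e1 : ∀ q, q ∈ P ∨ q ∈ Q ∨ q ∈ L →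
      ∑ x ∈ Finset.range q, κ q x ^ 1 = -(-1) ^ ((q + 1) / 4) := fun q hq => by
    rw [(hκ q hq).sum_pow 1 (by norm_num) (by norm_num), pow_one]
  have e2 : ∀ q, q ∈ P ∨ q ∈ Q ∨ q ∈ L → ∑ x ∈ Finset.range q, κ q x ^ 2 = -1 := fun q hq => by
    rw [(hκ q hq).sum_pow 2 (by norm_num) (by norm_num), neg_one_pow_sq]
  have e3 : ∀ q, q ∈ P ∨ q ∈ Q ∨ q ∈ L →
      ∑ x ∈ Finset.range q, κ q x ^ 3 = -(-1) ^ ((q + 1) / 4) := fun q hq => by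
    rw [(hκ q hq).sum_pow 3 (by norm_num) (by norm_num), hcube]
  have e4 : ∀ q, q ∈ P ∨ q ∈ Q ∨ q ∈ L →
      ∑ x ∈ Finset.range q, κ q x ^ 4 = (tauPrimePow q 1 : GaussianInt) :=
    fun q hq => (hκ q hq).sum_pow_four
  have e6 : ∀ q, q ∈ P ∨ q ∈ Q ∨ q ∈ L → ∑ x ∈ Finset.range q, κ q x ^ 6 = -1 := fun q hq => by
    rw [(hκ q hq).sum_pow_add_four (k := 2) (by norm_num), e2 q hq]
  have e8 : ∀ q, q ∈ P ∨ q ∈ Q ∨ q ∈ L →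
      ∑ x ∈ Finset.range q, κ q x ^ 8 = (tauPrimePow q 1 : GaussianInt) := fun q hq => by
    rw [(hκ q hq).sum_pow_add_four (k := 4) (by norm_num), e4 q hq]
  have e9 : ∀ q, q ∈ P ∨ q ∈ Q ∨ q ∈ L →
      ∑ x ∈ Finset.range q, κ q x ^ 9 = -(-1) ^ ((q + 1) / 4) := fun q hq => by
    rw [(hκ q hq).sum_pow_add_four (k := 5) (by norm_num),
      (hκ q hq).sum_pow_add_four (k := 1) (by norm_num), e1 q hq]
  have e12 : ∀ q, q ∈ P ∨ q ∈ Q ∨ q ∈ L →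
      ∑ x ∈ Finset.range q, κ q x ^ 12 = (tauPrimePow q 1 : GaussianInt) := fun q hq => by
    rw [(hκ q hq).sum_pow_add_four (k := 8) (by norm_num), e8 q hq]
  have h1 := hsum 1
  have h2 := hsum 2
  have h3 := hsum 3
  have h4 := hsum 4
  norm_num only at h1 h2 h3 h4
  rw [sum_twoSymbol_pow δ (by norm_num), Finset.prod_congr rfl fun q hq => e1 q (Or.inl hq),
    Finset.prod_congr rfl fun q hq => e2 q (Or.inr (Or.inl hq)),
    Finset.prod_congr rfl fun q hq => e3 q (Or.inr (Or.inr hq)),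
    prod_neg_sign hP, prod_neg_sign hL, Finset.prod_const] at h1
  rw [sum_twoSymbol_pow δ (by norm_num), Finset.prod_congr rfl fun q hq => e2 q (Or.inl hq),
    Finset.prod_congr rfl fun q hq => e4 q (Or.inr (Or.inl hq)),
    Finset.prod_congr rfl fun q hq => e6 q (Or.inr (Or.inr hq)),
    Finset.prod_const, Finset.prod_const, hδ] at h2
  rw [sum_twoSymbol_pow δ (by norm_num), Finset.prod_congr rfl fun q hq => e3 q (Or.inl hq),
    Finset.prod_congr rfl fun q hq => e6 q (Or.inr (Or.inl hq)),
    Finset.prod_congr rfl fun q hq => e9 q (Or.inr (Or.inr hq)),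
    prod_neg_sign hP, prod_neg_sign hL, Finset.prod_const, hδ3] at h3
  rw [sum_twoSymbol_pow δ (by norm_num), Finset.prod_congr rfl fun q hq => e4 q (Or.inl hq),
    Finset.prod_congr rfl fun q hq => e8 q (Or.inr (Or.inl hq)),
    Finset.prod_congr rfl fun q hq => e12 q (Or.inr (Or.inr hq)), hδ4] at h4
  simp only [pow_one] at h1
  refine ⟨?_, ?_, ?_⟩
  · rw [h4]; ring
  · rw [h2, pow_add]; ring
  · rw [h1, h3]; simp only [pow_add]; ring

end Moments

/-! ### The Euler product of the character modulo `4` at `s = 1` -/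

/-- The nontrivial character modulo `4`, with real values. -/
def chi (n : ℕ) : ℝ := (ZMod.χ₄ n : ℤ)

lemma chi_mul (m n : ℕ) : chi (m * n) = chi m * chi n := by
  rw [chi, Nat.cast_mul, map_mul, Int.cast_mul, chi, chi]

lemma abs_chi_le (n : ℕ) : |chi n| ≤ 1 := by
  rw [chi, ← Int.cast_abs]
  have h : ∀ a : ZMod 4, |ZMod.χ₄ a| ≤ 1 := by decide
  exact_mod_cast h n

lemma sum_range_chi (n : ℕ) : ∑ i ∈ Finset.range n, chi i = if n % 4 < 2 then 0 else 1 := by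
  induction n with
  | zero => simp
  | succ n ih =>
    rw [Finset.sum_range_succ, ih, chi, ZMod.χ₄_nat_eq_if_mod_four]
    rcases (show n % 4 = 0 ∨ n % 4 = 1 ∨ n % 4 = 2 ∨ n % 4 = 3 by omega) with h | h | h | h
    · simp [h, show n % 2 = 0 by omega, show (n + 1) % 4 = 1 by omega]
    · simp [h, show n % 2 = 1 by omega, show (n + 1) % 4 = 2 by omega]
    · simp [h, show n % 2 = 0 by omega, show (n + 1) % 4 = 3 by omega]
    · simp [h, show n % 2 = 1 by omega, show (n + 1) % 4 = 0 by omega]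

lemma abs_sum_Ico_chi_le {a b : ℕ} (hab : a ≤ b) : |∑ i ∈ Finset.Ico a b, chi i| ≤ 1 := by
  rw [Finset.sum_Ico_eq_sub _ hab, sum_range_chi, sum_range_chi]
  split_ifs <;> norm_num

/-- Abel summation: a block of the series `∑ χ(n) g(n)` with `g` decreasing is bounded by its first
coefficient. -/
lemma abs_sum_Ico_chi_mul_le {g : ℕ → ℝ} {a b : ℕ} (hab : a ≤ b) (hg : ∀ n, a ≤ n → 0 ≤ g n)
    (hg' : ∀ n, a ≤ n → g (n + 1) ≤ g n) :
    |∑ i ∈ Finset.Ico a b, chi i * g i| ≤ g a := by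
  have key : |∑ i ∈ Finset.Ico a b, chi i * g i - (∑ i ∈ Finset.Ico a b, chi i) * g b|
      ≤ g a - g b := by
    induction b, hab using Nat.le_induction with
    | base => simp
    | succ b hab ih =>
      have h1 := abs_sum_Ico_chi_le (Nat.le_succ_of_le hab)
      rw [Finset.sum_Ico_succ_top hab] at h1 ⊢
      rw [Finset.sum_Ico_succ_top hab]
      have h2 : 0 ≤ g b - g (b + 1) := sub_nonneg.2 (hg' b hab)
      calc _ = |(∑ i ∈ Finset.Ico a b, chi i * g i - (∑ i ∈ Finset.Ico a b, chi i) * g b)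
            + (∑ i ∈ Finset.Ico a b, chi i + chi b) * (g b - g (b + 1))| := by congr 1; ring
        _ ≤ (g a - g b) + 1 * (g b - g (b + 1)) := by
            refine (abs_add_le _ _).trans (add_le_add ih ?_)
            rw [abs_mul, abs_of_nonneg h2]
            exact mul_le_mul_of_nonneg_right h1 h2
        _ = g a - g (b + 1) := by ring
  have h3 : |(∑ i ∈ Finset.Ico a b, chi i) * g b| ≤ g b := by
    rw [abs_mul, abs_of_nonneg (hg b hab)]
    exact mul_le_of_le_one_left (hg b hab) (abs_sum_Ico_chi_le hab)
  calc |∑ i ∈ Finset.Ico a b, chi i * g i|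
      = |(∑ i ∈ Finset.Ico a b, chi i * g i - (∑ i ∈ Finset.Ico a b, chi i) * g b)
          + (∑ i ∈ Finset.Ico a b, chi i) * g b| := by congr 1; ring
    _ ≤ (g a - g b) + g b := (abs_add_le _ _).trans (add_le_add key h3)
    _ = g a := by ring

lemma abs_sum_Ico_chi_div_le {a b : ℕ} (ha : 0 < a) (hab : a ≤ b) :
    |∑ i ∈ Finset.Ico a b, chi i / i| ≤ 1 / a := by
  simp only [div_eq_mul_one_div (chi _)]
  refine abs_sum_Ico_chi_mul_le (g := fun n => 1 / (n : ℝ)) hab (fun n _ => by positivity) ?_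
  intro n hn
  have : (0 : ℝ) < n := by exact_mod_cast ha.trans_le hn
  exact one_div_le_one_div_of_le this (by push_cast; linarith)

/-- The series `L(1, χ₄)` converges to a nonzero limit, with error `O(1 / N)`. -/
lemma exists_LValue : ∃ ℓ : ℝ, ℓ ≠ 0 ∧
    ∀ N : ℕ, |ℓ - ∑ i ∈ Finset.range (N + 1), chi i / i| ≤ 1 / ((N : ℝ) + 1) := by
  have hb : ∀ M N : ℕ, M ≤ N → |∑ i ∈ Finset.range (N + 1), chi i / (i : ℝ)
      - ∑ i ∈ Finset.range (M + 1), chi i / (i : ℝ)| ≤ 1 / ((M : ℝ) + 1) := by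
    intro M N h
    rw [← Finset.sum_Ico_eq_sub _ (Nat.succ_le_succ h)]
    have := abs_sum_Ico_chi_div_le (Nat.succ_pos M) (Nat.succ_le_succ h)
    push_cast at this
    exact this
  have hc : CauchySeq fun N : ℕ => ∑ i ∈ Finset.range (N + 1), chi i / (i : ℝ) := by
    refine cauchySeq_of_le_tendsto_0' (fun N : ℕ => 1 / ((N : ℝ) + 1)) (fun M N h => ?_)
      tendsto_one_div_add_atTop_nhds_zero_nat
    rw [dist_comm, Real.dist_eq]
    exact hb M N h
  obtain ⟨ℓ, hℓ⟩ := cauchySeq_tendsto_of_complete hc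
  have hle : ∀ N : ℕ, |ℓ - ∑ i ∈ Finset.range (N + 1), chi i / i| ≤ 1 / ((N : ℝ) + 1) := by
    intro M
    refine le_of_tendsto ((hℓ.sub_const _).abs) ?_
    filter_upwards [eventually_ge_atTop M] with N hN
    exact hb M N hN
  refine ⟨ℓ, ?_, hle⟩
  rintro rfl
  have := hle 2
  rw [Finset.sum_range_succ, Finset.sum_range_succ, Finset.sum_range_one] at this
  have h0 : chi 0 = 0 := by simp [chi]
  have h1 : chi 1 = 1 := by simp [chi]
  have h2 : chi 2 = 0 := by
    rw [chi, show ZMod.χ₄ ((2 : ℕ) : ZMod 4) = 0 by decide]; norm_num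
  rw [h0, h1, h2] at this
  norm_num at this

lemma abs_sum_chi_log_le (N : ℕ) : |∑ n ∈ Finset.Ioc 0 N, chi n * Real.log n / n| ≤ 1 := by
  have hlog3 : Real.log 3 / 3 ≤ 1 := by
    have := Real.log_le_sub_one_of_pos (show (0 : ℝ) < 3 by norm_num)
    linarith
  -- `log n / n` decreases from `n = 3` on, and the terms with `n = 1, 2` vanish
  have hanti : ∀ n : ℕ, 3 ≤ n →
      Real.log ((n + 1 : ℕ) : ℝ) / ((n + 1 : ℕ) : ℝ) ≤ Real.log n / n := by
    intro n hn
    have h3 : (3 : ℝ) ≤ n := by exact_mod_cast hn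
    have he := Real.exp_one_lt_three
    exact Real.log_div_self_antitoneOn (Set.mem_Ici.2 (by linarith))
      (Set.mem_Ici.2 (by push_cast; linarith)) (by push_cast; linarith)
  have h2 : chi 2 = 0 := by
    rw [chi, show ZMod.χ₄ ((2 : ℕ) : ZMod 4) = 0 by decide]; norm_num
  have hsplit : ∑ n ∈ Finset.Ioc 0 N, chi n * Real.log n / n
      = ∑ n ∈ Finset.Ico 3 (N + 1), chi n * (Real.log n / n) := by
    simp only [← mul_div_assoc]
    refine (Finset.sum_subset_zero_on_sdiff ?_ ?_ fun _ _ => rfl).symm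
    · intro n hn
      rw [Finset.mem_Ico] at hn
      rw [Finset.mem_Ioc]; omega
    · intro n hn
      rw [Finset.mem_sdiff, Finset.mem_Ioc, Finset.mem_Ico] at hn
      rcases (show n = 1 ∨ n = 2 by omega) with rfl | rfl
      · simp
      · rw [h2]; simp
  rw [hsplit]
  rcases le_total 3 (N + 1) with h | h
  · refine (abs_sum_Ico_chi_mul_le (g := fun n : ℕ => Real.log n / n) h (fun n _ => ?_) hanti).trans
      (by exact_mod_cast hlog3)
    positivity
  · rw [Finset.Ico_eq_empty_of_le h]; simp

open ArithmeticFunction in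
/-- `∑ χ(d) Λ(d) / d` is bounded: expand `χ(n) log n / n` with `log = Λ * 1` and use
`L(1, χ) ≠ 0` together with Chebyshev's bound. -/
lemma exists_bound_sum_chi_vonMangoldt :
    ∃ B : ℝ, ∀ N : ℕ, |∑ n ∈ Finset.Ioc 0 N, chi n * vonMangoldt n / n| ≤ B := by
  obtain ⟨ℓ, hℓ0, hℓ⟩ := exists_LValue
  let f : ArithmeticFunction ℝ := ⟨fun n => chi n * vonMangoldt n / n, by simp⟩
  let g : ArithmeticFunction ℝ := ⟨fun n => chi n / n, by simp⟩
  have hf : ∀ n, f n = chi n * vonMangoldt n / n := fun _ => rfl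
  have hg : ∀ n, g n = chi n / n := fun _ => rfl
  have hfg : ∀ n, (f * g) n = chi n * Real.log n / n := by
    intro n
    rw [mul_apply, ← vonMangoldt_sum, Finset.mul_sum, Finset.sum_div,
      ← Nat.sum_divisorsAntidiagonal (fun i _ => chi n * vonMangoldt i / n)]
    refine Finset.sum_congr rfl fun z hz => ?_
    have h := (Nat.mem_divisorsAntidiagonal.1 hz).1
    rw [hf, hg, ← h, chi_mul]
    push_cast
    rw [div_mul_div_comm]
    ring
  have hgsum : ∀ K : ℕ, |ℓ - ∑ m ∈ Finset.Ioc 0 K, g m| ≤ 1 / ((K : ℝ) + 1) := by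
    intro K
    have : ∑ m ∈ Finset.Ioc 0 K, g m = ∑ i ∈ Finset.range (K + 1), chi i / (i : ℝ) := by
      refine Finset.sum_subset_zero_on_sdiff ?_ ?_ fun _ _ => rfl
      · intro n hn; rw [Finset.mem_Ioc] at hn; rw [Finset.mem_range]; omega
      · intro n hn
        rw [Finset.mem_sdiff, Finset.mem_Ioc, Finset.mem_range] at hn
        rw [show n = 0 by omega]; simp
    rw [this]; exact hℓ K
  refine ⟨(Real.log 4 + 5) / |ℓ|, fun N => ?_⟩
  rw [le_div_iff₀ (abs_pos.2 hℓ0), ← abs_mul]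
  rcases Nat.eq_zero_or_pos N with rfl | hN
  · simp only [Finset.Ioc_self, Finset.sum_empty, zero_mul, abs_zero]
    have := Real.log_nonneg (show (1 : ℝ) ≤ 4 by norm_num)
    linarith
  have hNpos : (0 : ℝ) < N := by exact_mod_cast hN
  have hid := sum_Ioc_mul_eq_sum_sum f g N
  simp only [hfg] at hid
  have hdec : (∑ n ∈ Finset.Ioc 0 N, chi n * vonMangoldt n / n) * ℓ
      = ∑ n ∈ Finset.Ioc 0 N, f n * (ℓ - ∑ m ∈ Finset.Ioc 0 (N / n), g m)
        + ∑ n ∈ Finset.Ioc 0 N, chi n * Real.log n / n := by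
    rw [hid, ← Finset.sum_add_distrib, Finset.sum_mul]
    exact Finset.sum_congr rfl fun n _ => by rw [hf]; ring
  have herr : |∑ n ∈ Finset.Ioc 0 N, f n * (ℓ - ∑ m ∈ Finset.Ioc 0 (N / n), g m)|
      ≤ Real.log 4 + 4 := by
    have hpsi := Chebyshev.psi_le_const_mul_self hNpos.le
    rw [Chebyshev.psi, Nat.floor_natCast] at hpsi
    calc _ ≤ ∑ n ∈ Finset.Ioc 0 N, |f n * (ℓ - ∑ m ∈ Finset.Ioc 0 (N / n), g m)| :=
          Finset.abs_sum_le_sum_abs _ _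
      _ ≤ ∑ n ∈ Finset.Ioc 0 N, vonMangoldt n / N := by
          refine Finset.sum_le_sum fun n hn => ?_
          have hn0 : 0 < n := (Finset.mem_Ioc.1 hn).1
          have hnpos : (0 : ℝ) < n := by exact_mod_cast hn0
          have h1 : |f n| ≤ vonMangoldt n / n := by
            rw [hf, abs_div, abs_mul, abs_of_nonneg (vonMangoldt_nonneg), Nat.abs_cast]
            gcongr
            exact mul_le_of_le_one_left vonMangoldt_nonneg (abs_chi_le n)
          have h2 : |ℓ - ∑ m ∈ Finset.Ioc 0 (N / n), g m| ≤ n / N := by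
            refine (hgsum _).trans ?_
            rw [div_le_div_iff₀ (by positivity) hNpos, one_mul]
            have h3 : N < n * (N / n + 1) := Nat.lt_mul_div_succ N hn0
            exact_mod_cast h3.le
          rw [abs_mul]
          calc _ ≤ vonMangoldt n / n * (n / N) :=
                mul_le_mul h1 h2 (abs_nonneg _) (div_nonneg vonMangoldt_nonneg hnpos.le)
            _ = vonMangoldt n / N := by field_simp
      _ = (∑ n ∈ Finset.Ioc 0 N, vonMangoldt n) / N := by rw [Finset.sum_div]
      _ ≤ Real.log 4 + 4 := by rw [div_le_iff₀ hNpos]; exact hpsi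
  rw [hdec]
  refine (abs_add_le _ _).trans ?_
  linarith [abs_sum_chi_log_le N]

/-- The coefficient of `p` in the Euler product: `χ₄(p)` at the primes not dividing `M`. -/
noncomputable def eulerCoeff (M n : ℕ) : ℝ := if n.Prime ∧ ¬ n ∣ M then chi n else 0

lemma abs_eulerCoeff_le (M n : ℕ) : |eulerCoeff M n| ≤ 1 := by
  rw [eulerCoeff]; split_ifs
  · exact abs_chi_le n
  · simp

open ArithmeticFunction in
lemma exists_bound_sum_eulerCoeff_log {M : ℕ} (hM : M ≠ 0) :
    ∃ B : ℝ, ∀ N : ℕ, |∑ n ∈ Finset.range N, eulerCoeff M n * Real.log n / n| ≤ B := by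
  obtain ⟨B, hB⟩ := exists_bound_sum_chi_vonMangoldt
  -- the two series differ by the proper prime powers and by the primes dividing `M`
  have hsum1 : Summable fun n : ℕ => (if n.Prime then 0 else vonMangoldt n) / n := by
    have h := vonMangoldt.summable_residueClass_non_primes_div (0 : ZMod 1)
    refine h.congr fun n => ?_
    have : (vonMangoldt.residueClass (0 : ZMod 1)) n = vonMangoldt n := by
      rw [vonMangoldt.residueClass, Set.indicator_apply, if_pos]
      exact Subsingleton.elim _ _
    rw [this]
  have hsum2 : Summable fun n : ℕ => if n ∣ M then vonMangoldt n / n else 0 := by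
    refine summable_of_ne_finset_zero (s := M.divisors) fun n hn => if_neg ?_
    rw [Nat.mem_divisors] at hn
    tauto
  have hsum := hsum1.add hsum2
  have hle : ∀ n : ℕ, |chi n * vonMangoldt n / n - eulerCoeff M n * Real.log n / n|
      ≤ (if n.Prime then 0 else vonMangoldt n) / n + (if n ∣ M then vonMangoldt n / n else 0) := by
    intro n
    have hc : |chi n * vonMangoldt n / n| ≤ vonMangoldt n / n := by
      rw [abs_div, abs_mul, abs_of_nonneg (vonMangoldt_nonneg), Nat.abs_cast]
      gcongr
      exact mul_le_of_le_one_left vonMangoldt_nonneg (abs_chi_le n)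
    have h0 : 0 ≤ vonMangoldt n / (n : ℝ) := div_nonneg vonMangoldt_nonneg (Nat.cast_nonneg n)
    rw [eulerCoeff]
    by_cases hp : n.Prime
    · by_cases hd : n ∣ M
      · simp only [hp, hd, not_true_eq_false, and_false, if_false, if_true, zero_mul, zero_div,
          sub_zero, zero_add]
        exact hc
      · simp [hp, hd, vonMangoldt_apply_prime hp]
    · simp only [hp, false_and, if_false, zero_mul, zero_div, sub_zero]
      split_ifs <;> linarith
  refine ⟨B + ∑' n : ℕ, ((if n.Prime then 0 else vonMangoldt n) / n
    + (if n ∣ M then vonMangoldt n / n else 0)), fun N => ?_⟩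
  have h1 : |∑ n ∈ Finset.range N, chi n * vonMangoldt n / n| ≤ B := by
    rcases N with _ | N
    · simpa using hB 0
    · have : ∑ n ∈ Finset.range (N + 1), chi n * vonMangoldt n / n
          = ∑ n ∈ Finset.Ioc 0 N, chi n * vonMangoldt n / n := by
        refine (Finset.sum_subset_zero_on_sdiff ?_ ?_ fun _ _ => rfl).symm
        · intro n hn; rw [Finset.mem_Ioc] at hn; rw [Finset.mem_range]; omega
        · intro n hn
          rw [Finset.mem_sdiff, Finset.mem_Ioc, Finset.mem_range] at hn
          rw [show n = 0 by omega]; simp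
      rw [this]; exact hB N
  have h2 : |∑ n ∈ Finset.range N,
      (chi n * vonMangoldt n / n - eulerCoeff M n * Real.log n / n)|
      ≤ ∑' n : ℕ, ((if n.Prime then 0 else vonMangoldt n) / n
        + (if n ∣ M then vonMangoldt n / n else 0)) :=
    (Finset.abs_sum_le_sum_abs _ _).trans <| (Finset.sum_le_sum fun n _ => hle n).trans <|
      hsum.sum_le_tsum _ fun n _ => (abs_nonneg _).trans (hle n)
  rw [Finset.sum_sub_distrib] at h2
  have := abs_sub_abs_le_abs_sub (∑ n ∈ Finset.range N, eulerCoeff M n * Real.log n / n)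
    (∑ n ∈ Finset.range N, chi n * vonMangoldt n / n)
  rw [abs_sub_comm] at h2
  linarith

/-- Partial summation gives the convergence of `∑ χ(p) / p`. -/
lemma exists_tendsto_sum_eulerCoeff_div {M : ℕ} (hM : M ≠ 0) :
    ∃ l : ℝ, Tendsto (fun N => ∑ n ∈ Finset.range N, eulerCoeff M n / n) atTop (𝓝 l) := by
  obtain ⟨B, hB⟩ := exists_bound_sum_eulerCoeff_log hM
  have h0 : ∀ g : ℕ → ℝ, eulerCoeff M 0 * g 0 = 0 ∧ eulerCoeff M 1 * g 1 = 0 := fun g => by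
    simp [eulerCoeff, Nat.not_prime_zero, Nat.not_prime_one]
  have hlogpos : ∀ n : ℕ, 0 < Real.log ((n : ℝ) + 2) := fun n =>
    Real.log_pos (by have : (0 : ℝ) ≤ n := n.cast_nonneg; linarith)
  have hanti : Antitone fun n : ℕ => (Real.log ((n : ℝ) + 2))⁻¹ := by
    intro m n hmn
    refine inv_anti₀ (hlogpos m) (Real.log_le_log (by positivity) ?_)
    have : (m : ℝ) ≤ n := by exact_mod_cast hmn
    linarith
  have hzero : Tendsto (fun n : ℕ => (Real.log ((n : ℝ) + 2))⁻¹) atTop (𝓝 0) :=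
    tendsto_inv_atTop_zero.comp <| Real.tendsto_log_atTop.comp <|
      tendsto_atTop_add_const_right _ _ tendsto_natCast_atTop_atTop
  have hbd : ∀ N, ‖∑ i ∈ Finset.range N,
      eulerCoeff M (i + 2) * Real.log ((i : ℝ) + 2) / ((i : ℝ) + 2)‖ ≤ B := by
    intro N
    have := hB (N + 2)
    rw [Finset.sum_range_succ', Finset.sum_range_succ'] at this
    simp only [mul_div_assoc, zero_add] at this
    rw [(h0 fun n => Real.log n / n).1, (h0 fun n => Real.log n / n).2, add_zero, add_zero] at this
    rw [Real.norm_eq_abs]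
    convert this using 3 with i
    rw [mul_div_assoc, show ((i + 1 + 1 : ℕ) : ℝ) = (i : ℝ) + 2 by push_cast; ring]
  have hc := hanti.cauchySeq_series_mul_of_tendsto_zero_of_bounded hzero hbd
  obtain ⟨l, hl⟩ := cauchySeq_tendsto_of_complete hc
  refine ⟨l, (tendsto_add_atTop_iff_nat 2).1 ?_⟩
  convert hl using 2 with N
  rw [Finset.sum_range_succ', Finset.sum_range_succ']
  simp only [div_eq_mul_inv, zero_add]
  rw [(h0 fun n => (n : ℝ)⁻¹).1, (h0 fun n => (n : ℝ)⁻¹).2, add_zero, add_zero]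
  refine Finset.sum_congr rfl fun i _ => ?_
  have := hlogpos i
  have h2 : ((i + 1 + 1 : ℕ) : ℝ) = (i : ℝ) + 2 := by push_cast; ring
  rw [smul_eq_mul, h2]
  field_simp

lemma abs_log_one_sub_add_le {x : ℝ} (hx : |x| ≤ 1 / 2) : |Real.log (1 - x) + x| ≤ 2 * x ^ 2 := by
  have h := Real.abs_log_sub_add_sum_range_le (show |x| < 1 by linarith) 1
  simp only [Finset.sum_range_one, zero_add, pow_one, Nat.cast_zero, div_one] at h
  rw [add_comm]
  refine h.trans ?_
  rw [div_le_iff₀ (by linarith), ← sq_abs x]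
  have h1 := mul_nonneg (sq_nonneg |x|) (sub_nonneg.2 hx)
  rw [show 1 + 1 = 2 from rfl]
  linarith

lemma eulerCoeff_div_le (M n : ℕ) : |eulerCoeff M n / ((n : ℝ) - 1)| ≤ 1 / 2 := by
  by_cases hn : n.Prime ∧ n ≠ 2
  · have h3 : (3 : ℝ) ≤ n := by
      have := hn.1.two_le
      exact_mod_cast (show 3 ≤ n by have := hn.2; omega)
    rw [abs_div, abs_of_nonneg (show (0 : ℝ) ≤ (n : ℝ) - 1 by linarith),
      div_le_div_iff₀ (by linarith) (by norm_num)]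
    have := abs_eulerCoeff_le M n
    linarith
  · have : eulerCoeff M n = 0 := by
      rw [eulerCoeff]
      split_ifs with h
      · have : n = 2 := by tauto
        rw [this, chi, show ZMod.χ₄ ((2 : ℕ) : ZMod 4) = 0 by decide]; norm_num
      · rfl
    rw [this]; norm_num

/-- The logarithm of the product differs from `-∑ χ(p) / p` by an absolutely convergent series. -/
lemma exists_tendsto_prod_eulerCoeff {M : ℕ} (hM : M ≠ 0) :
    ∃ C : ℝ, 0 < C ∧ Tendsto (fun N => ∏ n ∈ Finset.range N, (1 - eulerCoeff M n / ((n : ℝ) - 1)))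
      atTop (𝓝 C) := by
  obtain ⟨l, hl⟩ := exists_tendsto_sum_eulerCoeff_div hM
  have hpos : ∀ n : ℕ, 0 < 1 - eulerCoeff M n / ((n : ℝ) - 1) := fun n => by
    have := (abs_le.1 (eulerCoeff_div_le M n)).2
    linarith
  have hsum : Summable fun n : ℕ =>
      Real.log (1 - eulerCoeff M n / ((n : ℝ) - 1)) + eulerCoeff M n / n := by
    have hs : Summable fun n : ℕ => 10 * (1 / (n : ℝ) ^ 2) :=
      (Real.summable_one_div_nat_pow.2 (by norm_num)).mul_left 10
    refine Summable.of_norm_bounded hs fun n => ?_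
    rw [Real.norm_eq_abs]
    by_cases hn : n < 2
    · have : eulerCoeff M n = 0 := by
        rw [eulerCoeff, if_neg]
        exact fun h => absurd h.1.two_le (by omega)
      rw [this]; simp
    have hn2 : (2 : ℝ) ≤ n := by exact_mod_cast (not_lt.1 hn)
    have hc := abs_eulerCoeff_le M n
    have hc2 : eulerCoeff M n ^ 2 ≤ 1 := by rw [sq_le_one_iff_abs_le_one]; exact hc
    have h1 := abs_log_one_sub_add_le (eulerCoeff_div_le M n)
    have h2 : 2 * (eulerCoeff M n / ((n : ℝ) - 1)) ^ 2 ≤ 8 * (1 / (n : ℝ) ^ 2) := by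
      rw [div_pow, mul_div_assoc', mul_one_div, div_le_div_iff₀ (by nlinarith) (by positivity)]
      nlinarith [sq_nonneg ((n : ℝ) - 2), sq_nonneg (n : ℝ)]
    have h3 : |eulerCoeff M n / n - eulerCoeff M n / ((n : ℝ) - 1)| ≤ 2 * (1 / (n : ℝ) ^ 2) := by
      have h4 : eulerCoeff M n / n - eulerCoeff M n / ((n : ℝ) - 1)
          = -(eulerCoeff M n / (n * ((n : ℝ) - 1))) := by
        have : (n : ℝ) - 1 ≠ 0 := by linarith
        field_simp
        ring
      rw [h4, abs_neg, abs_div, abs_of_pos (show (0 : ℝ) < n * ((n : ℝ) - 1) by nlinarith),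
        mul_one_div, div_le_div_iff₀ (by nlinarith) (by positivity)]
      nlinarith [abs_nonneg (eulerCoeff M n)]
    calc _ = |(Real.log (1 - eulerCoeff M n / ((n : ℝ) - 1)) + eulerCoeff M n / ((n : ℝ) - 1))
          + (eulerCoeff M n / n - eulerCoeff M n / ((n : ℝ) - 1))| := by congr 1; ring
      _ ≤ _ := (abs_add_le _ _).trans (by linarith)
  have hlim := hsum.hasSum.tendsto_sum_nat.sub hl
  simp only [← Finset.sum_sub_distrib, add_sub_cancel_right] at hlim
  refine ⟨_, Real.exp_pos _, ((Real.continuous_exp.tendsto _).comp hlim).congr fun N => ?_⟩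
  rw [Function.comp_apply, Real.exp_sum]
  exact Finset.prod_congr rfl fun n _ => Real.exp_log (hpos n)

/-- The Hardy-Littlewood product of a polynomial with discriminant `-m²` converges to a positive
limit: up to an absolutely convergent product it is the Euler product of `1 / L(1, χ₄)`. -/
lemma exists_tendsto_hlPartialProduct {a b c m : ℤ} (ha : a ≠ 0) (hm : m ≠ 0)
    (hΔ : b ^ 2 - 4 * a * c = -m ^ 2) :
    ∃ C : ℝ, 0 < C ∧ Tendsto (hlPartialProduct a b c) atTop (𝓝 C) := by
  have hM : (a * m).natAbs ≠ 0 := Int.natAbs_ne_zero.2 (mul_ne_zero ha hm)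
  obtain ⟨C, hC, hlim⟩ := exists_tendsto_prod_eulerCoeff hM
  refine ⟨C, hC, ((tendsto_add_atTop_iff_nat 1).2 hlim).congr fun n => ?_⟩
  rw [hlPartialProduct, Finset.prod_filter]
  refine Finset.prod_congr rfl fun p _ => ?_
  by_cases hp : p.Prime
  swap
  · rw [if_neg (by tauto), eulerCoeff, if_neg (by tauto)]; simp
  have hpp : Prime (p : ℤ) := Nat.prime_iff_prime_int.1 hp
  by_cases h2 : 2 < p
  swap
  · rw [if_neg (by tauto), eulerCoeff, show p = 2 by have := hp.two_le; omega, chi,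
      show ZMod.χ₄ ((2 : ℕ) : ZMod 4) = 0 by decide]
    simp
  have hodd : Odd p := hp.odd_of_ne_two (by omega)
  have hdvd : p ∣ (a * m).natAbs ↔ (p : ℤ) ∣ a ∨ (p : ℤ) ∣ m := by
    rw [← Int.natCast_dvd, hpp.dvd_mul]
  by_cases hpa : (p : ℤ) ∣ a
  · rw [if_neg (by tauto), eulerCoeff, if_neg (by tauto)]; simp
  rw [if_pos ⟨hp, h2, hpa⟩, hΔ, jacobiSym.neg _ hodd, eulerCoeff]
  by_cases hpm : (p : ℤ) ∣ m
  · rw [if_neg (by tauto), jacobiSym.pow_left, jacobiSym.eq_zero_iff.2]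
    · simp
    · refine ⟨hp.ne_zero, fun h => ?_⟩
      have := Int.dvd_gcd hpm dvd_rfl
      rw [h] at this
      exact hp.one_lt.ne' (Nat.dvd_one.1 this)
  · rw [if_pos (by tauto), jacobiSym.sq_one', mul_one, chi]
    rw [Int.gcd_comm]
    exact Int.isCoprime_iff_gcd_eq_one.1 ((Prime.coprime_iff_not_dvd hpp).2 hpm)

/-! ### Densities of residue classes under the Hardy-Littlewood conjecture -/

/-- All classes `x ≡ x₀ (mod M)` have the same positive Hardy-Littlewood constant: the discriminant
of `(M y + x₀)² + α²` does not depend on `x₀`. -/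
lemma exists_hlConstant_eq {M : ℕ} (hM : 0 < M) (hMe : Even M) {α : ℤ} (hα : α ≠ 0) :
    ∃ K : ℝ, 0 < K ∧ ∀ x₀ : ℕ,
      hlConstant ((M : ℤ) ^ 2) (2 * M * x₀) ((x₀ : ℤ) ^ 2 + α ^ 2) = K := by
  have hM0 : (M : ℤ) ≠ 0 := by exact_mod_cast hM.ne'
  have hMpos : (0 : ℝ) < M := by exact_mod_cast hM
  have hΔ : ∀ x₀ : ℕ, (2 * (M : ℤ) * x₀) ^ 2 - 4 * (M : ℤ) ^ 2 * ((x₀ : ℤ) ^ 2 + α ^ 2)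
      = -(2 * M * α) ^ 2 := fun x₀ => by ring
  obtain ⟨C, hC, hlim⟩ := exists_tendsto_hlPartialProduct (pow_ne_zero 2 hM0)
    (mul_ne_zero (mul_ne_zero two_ne_zero hM0) hα) (hΔ 0)
  refine ⟨2 / M * (∏ p ∈ M.primeFactors.filter (fun p => 2 < p), (p : ℝ) / ((p : ℝ) - 1)) * C,
    ?_, fun x₀ => ?_⟩
  · refine mul_pos (mul_pos (by positivity) (Finset.prod_pos fun p hp => ?_)) hC
    have : (2 : ℝ) < p := by exact_mod_cast (Finset.mem_filter.1 hp).2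
    exact div_pos (by linarith) (by linarith)
  · have h1 : hlPartialProduct ((M : ℤ) ^ 2) (2 * M * x₀) ((x₀ : ℤ) ^ 2 + α ^ 2)
        = hlPartialProduct ((M : ℤ) ^ 2) (2 * M * (0 : ℕ)) (((0 : ℕ) : ℤ) ^ 2 + α ^ 2) := by
      funext n
      rw [hlPartialProduct, hlPartialProduct, hΔ, hΔ]
    have h2 : Int.gcd 2 ((M : ℤ) ^ 2 + 2 * M * x₀) = 2 := by
      obtain ⟨k, hk⟩ := hMe
      have : (2 : ℤ) ∣ (M : ℤ) ^ 2 + 2 * M * x₀ :=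
        ⟨k * M + M * x₀, by rw [hk]; push_cast; ring⟩
      exact_mod_cast Int.gcd_eq_left (by norm_num) this
    have h3 : ((M : ℤ) ^ 2).natAbs.primeFactors.filter
        (fun p : ℕ => (p : ℤ) ∣ 2 * M * x₀ ∧ 2 < p) = M.primeFactors.filter (fun p => 2 < p) := by
      rw [Int.natAbs_pow, Int.natAbs_natCast, Nat.primeFactors_pow _ two_ne_zero]
      refine Finset.filter_congr fun p hp => ?_
      have : (p : ℤ) ∣ M := Int.natCast_dvd_natCast.2 (Nat.dvd_of_mem_primeFactors hp)
      exact and_iff_right ((this.mul_left 2).mul_right _)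
    rw [hlConstant, h1, hlim.limUnder_eq, h2, h3]
    push_cast
    rw [Real.sqrt_sq hMpos.le]

/-- The primes `p < n` of the form `α² + x²` with `x ≡ x₀ (mod M)` and `x ≥ 0`. -/
def classPrimes (α : ℤ) (M x₀ n : ℕ) : Set ℕ :=
  {p : ℕ | p.Prime ∧ p < n ∧ ∃ x : ℕ, (p : ℤ) = α ^ 2 + (x : ℤ) ^ 2 ∧ x % M = x₀}

lemma hlCount_eq_ncard {α : ℤ} {M x₀ : ℕ} (hx₀ : x₀ < M) (n : ℕ) :
    hlCount ((M : ℤ) ^ 2) (2 * M * x₀) ((x₀ : ℤ) ^ 2 + α ^ 2) n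
      = (classPrimes α M x₀ n).ncard := by
  rw [hlCount, classPrimes]
  congr 1
  ext p
  refine and_congr_right fun _ => and_congr_right fun _ => ⟨?_, ?_⟩
  · rintro ⟨y, hy⟩
    refine ⟨M * y + x₀, ?_, ?_⟩
    · rw [hy]; push_cast; ring
    · rw [Nat.mul_add_mod, Nat.mod_eq_of_lt hx₀]
  · rintro ⟨x, hx, hmod⟩
    refine ⟨x / M, ?_⟩
    have : (x : ℤ) = M * (x / M : ℕ) + x₀ := by
      rw [← hmod]; exact_mod_cast (Nat.div_add_mod x M).symm
    rw [hx, this]; ring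

/-- The comparison function of the Hardy-Littlewood conjecture. -/
noncomputable def hlScale (n : ℕ) : ℝ := √(n : ℝ) / Real.log n

lemma tendsto_hlScale : Tendsto hlScale atTop atTop := by
  have h1 : Tendsto (fun x : ℝ => Real.log x / x ^ (1 / 2 : ℝ)) atTop (𝓝 0) :=
    (isLittleO_log_rpow_atTop (by norm_num)).tendsto_div_nhds_zero
  have h2 : Tendsto (fun x : ℝ => Real.log x / x ^ (1 / 2 : ℝ)) atTop (𝓝[>] 0) := by
    refine tendsto_nhdsWithin_iff.2 ⟨h1, ?_⟩
    filter_upwards [eventually_gt_atTop 1] with x hx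
    exact div_pos (Real.log_pos hx) (Real.rpow_pos_of_pos (by linarith) _)
  refine ((tendsto_inv_nhdsGT_zero.comp h2).comp tendsto_natCast_atTop_atTop).congr fun n => ?_
  rw [Function.comp_apply, Function.comp_apply, inv_div, ← Real.sqrt_eq_rpow, hlScale]

lemma tendsto_classPrimes (hHL : HardyLittlewoodConjecture) {α : ℤ} (hα : α ≠ 0) {M : ℕ}
    (hM : 0 < M) (hMe : Even M) :
    ∃ K : ℝ, 0 < K ∧ ∀ x₀ : ℕ, x₀ < M → Nat.Coprime (x₀ ^ 2 + α.natAbs ^ 2) M →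
      Tendsto (fun n => ((classPrimes α M x₀ n).ncard : ℝ) / hlScale n) atTop (𝓝 K) := by
  obtain ⟨K, hK, hconst⟩ := exists_hlConstant_eq hM hMe hα
  refine ⟨K, hK, fun x₀ hx₀ hcop => ?_⟩
  have hMZ : (0 : ℤ) < M := by exact_mod_cast hM
  have hc : ((x₀ : ℤ) ^ 2 + α ^ 2) = ((x₀ ^ 2 + α.natAbs ^ 2 : ℕ) : ℤ) := by
    push_cast; rw [sq_abs]
  have h := hHL ((M : ℤ) ^ 2) (2 * M * x₀) ((x₀ : ℤ) ^ 2 + α ^ 2) (by positivity)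
    (by
      have h1 : IsCoprime ((M : ℤ) ^ 2) ((x₀ : ℤ) ^ 2 + α ^ 2) := by
        rw [hc]
        exact IsCoprime.pow_left (Nat.isCoprime_iff_coprime.2 hcop.symm)
      have h2 := Int.isCoprime_iff_gcd_eq_one.1 h1
      have h3 : Int.gcd ((M : ℤ) ^ 2) (Int.gcd (2 * M * x₀) ((x₀ : ℤ) ^ 2 + α ^ 2))
          ∣ Int.gcd ((M : ℤ) ^ 2) ((x₀ : ℤ) ^ 2 + α ^ 2) :=
        Int.dvd_gcd (Int.gcd_dvd_left ..)
          ((Int.gcd_dvd_right ..).trans (Int.gcd_dvd_right ..))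
      rw [h2] at h3
      exact Nat.dvd_one.1 h3)
    (by
      rintro ⟨_, h2⟩
      rw [hc] at h2
      have h3 : 2 ∣ x₀ ^ 2 + α.natAbs ^ 2 := (Int.even_coe_nat _).1 h2 |>.two_dvd
      exact Nat.not_coprime_of_dvd_of_dvd one_lt_two h3 hMe.two_dvd hcop)
    (by
      rintro ⟨y, hy⟩
      have h1 : (2 * (M : ℤ) * x₀) ^ 2 - 4 * (M : ℤ) ^ 2 * ((x₀ : ℤ) ^ 2 + α ^ 2)
        = -(2 * M * α) ^ 2 := by ring
      have h2 : 0 < (2 * (M : ℤ) * α) ^ 2 :=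
        lt_of_le_of_ne (sq_nonneg _)
          (pow_ne_zero 2 (mul_ne_zero (mul_ne_zero two_ne_zero hMZ.ne') hα)).symm
      nlinarith [mul_self_nonneg y])
  simp only [hlCount_eq_ncard hx₀, hconst] at h
  have hne : ∀ᶠ n in atTop, K * (√((n : ℕ) : ℝ) / Real.log n) ≠ 0 := by
    filter_upwards [tendsto_hlScale.eventually_gt_atTop 0] with n hn
    exact (mul_pos hK hn).ne'
  have h1 := ((isEquivalent_iff_tendsto_one hne).1 h).mul_const K
  rw [one_mul] at h1
  refine h1.congr fun n => ?_
  rw [Pi.div_apply, hlScale]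
  field_simp

lemma classPrimes_finite (α : ℤ) (M x₀ n : ℕ) : (classPrimes α M x₀ n).Finite :=
  (Set.finite_lt_nat n).subset fun _ hp => hp.2.1

lemma ncard_biUnion_classPrimes (α : ℤ) (M n : ℕ) (G : Finset ℕ) :
    (⋃ x₀ ∈ G, classPrimes α M x₀ n).ncard = ∑ x₀ ∈ G, (classPrimes α M x₀ n).ncard := by
  classical
  induction G using Finset.induction_on with
  | empty => simp
  | insert a G ha ih =>
    rw [Finset.set_biUnion_insert, Finset.sum_insert ha, ← ih]
    refine Set.ncard_union_eq ?_ (classPrimes_finite _ _ _ _)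
      (G.finite_toSet.biUnion fun _ _ => classPrimes_finite _ _ _ _)
    rw [Set.disjoint_left]
    rintro p ⟨_, _, x, hx, hxa⟩ hp
    simp only [Set.mem_iUnion] at hp
    obtain ⟨b, hb, _, _, y, hy, hyb⟩ := hp
    have hxy : x = y := by
      have : (x : ℤ) ^ 2 = (y : ℤ) ^ 2 := by linarith
      have h2 : x ^ 2 = y ^ 2 := by exact_mod_cast this
      exact Nat.pow_left_injective two_ne_zero h2
    apply ha
    rw [← hxa, hxy, hyb]
    exact hb

/-- If membership of `p = α² + x²` among the primes with trace `2 r` is decided by a set `G` of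
residue classes of `x` modulo `M`, then the density is the proportion of `G` among the admissible
classes. -/
theorem hasTraceDensity_of_residues (hHL : HardyLittlewoodConjecture) {α r D : ℤ} (hα : α ≠ 0)
    (hr : r ^ 2 = α ^ 2) {M : ℕ} (hM : 0 < M) (hMe : Even M) {A G : Finset ℕ}
    (hA : A = (Finset.range M).filter fun x => Nat.Coprime (x ^ 2 + α.natAbs ^ 2) M)
    (hA0 : A.Nonempty) (hGA : G ⊆ A)
    (hT : ∀ N p, p ∈ primesWithTrace D r N ↔
      p.Prime ∧ p ≤ N ∧ ∃ x : ℕ, (p : ℤ) = α ^ 2 + (x : ℤ) ^ 2 ∧ x % M ∈ G) :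
    HasTraceDensity D r ((G.card : ℝ) / A.card) := by
  obtain ⟨K, hK, hlim⟩ := tendsto_classPrimes hHL hα hM hMe
  have hsets : ∀ (H : Finset ℕ) N p, p ∈ (⋃ x₀ ∈ H, classPrimes α M x₀ (N + 1)) ↔
      p.Prime ∧ p ≤ N ∧ ∃ x : ℕ, (p : ℤ) = α ^ 2 + (x : ℤ) ^ 2 ∧ x % M ∈ H := by
    intro H N p
    simp only [Set.mem_iUnion, classPrimes, Set.mem_ofPred_eq, Nat.lt_succ_iff]
    constructor
    · rintro ⟨x₀, h0, hp, hN, x, hx, rfl⟩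
      exact ⟨hp, hN, x, hx, h0⟩
    · rintro ⟨hp, hN, x, hx, h0⟩
      exact ⟨_, h0, hp, hN, x, hx, rfl⟩
  have hcount : ∀ H : Finset ℕ, H ⊆ A → Tendsto (fun N : ℕ =>
      ((⋃ x₀ ∈ H, classPrimes α M x₀ (N + 1)).ncard : ℝ) / hlScale (N + 1)) atTop
      (𝓝 (H.card * K)) := by
    intro H hH
    have h1 := tendsto_finsetSum H fun x₀ hx₀ => by
      have h2 := hH hx₀
      rw [hA, Finset.mem_filter, Finset.mem_range] at h2
      exact (tendsto_add_atTop_iff_nat 1).2 (hlim x₀ h2.1 h2.2)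
    rw [Finset.sum_const, nsmul_eq_mul] at h1
    refine h1.congr fun N => ?_
    rw [ncard_biUnion_classPrimes, Nat.cast_sum, Finset.sum_div]
  -- outside the admissible classes `p` divides `M`
  have hform : ∀ N, ∃ e : ℕ, e ≤ M.primeFactors.card ∧ (primesOfForm r N).ncard
      = (⋃ x₀ ∈ A, classPrimes α M x₀ (N + 1)).ncard + e := by
    intro N
    have hsub : (⋃ x₀ ∈ A, classPrimes α M x₀ (N + 1)) ⊆ primesOfForm r N := by
      intro p hp
      obtain ⟨h1, h2, x, hx, _⟩ := (hsets A N p).1 hp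
      exact ⟨h1, h2, x, by rw [hr, hx]⟩
    have hfin : (primesOfForm r N).Finite :=
      (Set.finite_le_nat N).subset fun _ hp => hp.2.1
    have hdiff : primesOfForm r N \ (⋃ x₀ ∈ A, classPrimes α M x₀ (N + 1))
        ⊆ (M.primeFactors : Set ℕ) := by
      rintro p ⟨⟨h1, h2, x, hx⟩, h3⟩
      rw [hsets] at h3
      have hx' : (p : ℤ) = α ^ 2 + (x.natAbs : ℤ) ^ 2 := by rw [hx, hr, Int.natAbs_sq]
      have h4 : x.natAbs % M ∉ A := fun h => h3 ⟨h1, h2, x.natAbs, hx', h⟩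
      rw [hA, Finset.mem_filter, Finset.mem_range, not_and] at h4
      obtain ⟨l, hl, hl1, hl2⟩ := Nat.Prime.not_coprime_iff_dvd.1 (h4 (Nat.mod_lt _ hM))
      have hpN : p = x.natAbs ^ 2 + α.natAbs ^ 2 := by
        have : (p : ℤ) = ((x.natAbs ^ 2 + α.natAbs ^ 2 : ℕ) : ℤ) := by
          rw [hx']; push_cast; rw [sq_abs, sq_abs]; ring
        exact_mod_cast this
      have hlp : l ∣ p := by
        rw [hpN]
        have h5 : (x.natAbs % M) ^ 2 + α.natAbs ^ 2 ≡ x.natAbs ^ 2 + α.natAbs ^ 2 [MOD l] :=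
          (((Nat.mod_modEq _ M).of_dvd hl2).pow 2).add_right _
        exact (h5.dvd_iff dvd_rfl).1 hl1
      rw [(Nat.prime_dvd_prime_iff_eq hl h1).1 hlp] at hl2
      exact Nat.mem_primeFactors.2 ⟨h1, hl2, hM.ne'⟩
    refine ⟨(primesOfForm r N \ (⋃ x₀ ∈ A, classPrimes α M x₀ (N + 1))).ncard, ?_, ?_⟩
    · rw [← Set.ncard_coe_finset]
      exact Set.ncard_le_ncard hdiff (Finset.finite_toSet _)
    · rw [add_comm]; exact (Set.ncard_sdiff_add_ncard_of_subset hsub hfin).symm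
  choose e he hform using hform
  have hscale : Tendsto (fun N : ℕ => hlScale (N + 1)) atTop atTop :=
    (tendsto_add_atTop_iff_nat 1).2 tendsto_hlScale
  have herr : Tendsto (fun N => (e N : ℝ) / hlScale (N + 1)) atTop (𝓝 0) := by
    refine squeeze_zero' ?_ ?_ (hscale.const_div_atTop (M.primeFactors.card : ℝ))
    · filter_upwards [hscale.eventually_gt_atTop 0] with N hN
      exact div_nonneg (Nat.cast_nonneg _) hN.le
    · filter_upwards [hscale.eventually_gt_atTop 0] with N hN
      exact div_le_div_of_nonneg_right (by exact_mod_cast he N) hN.le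
  have hden := (hcount A subset_rfl).add herr
  rw [add_zero] at hden
  have hA0' : (A.card : ℝ) ≠ 0 := by exact_mod_cast (Finset.card_pos.2 hA0).ne'
  have hfinal := (hcount G hGA).div hden (mul_ne_zero hA0' hK.ne')
  rw [mul_div_mul_right _ _ hK.ne'] at hfinal
  refine hfinal.congr' ?_
  filter_upwards [hscale.eventually_gt_atTop 0] with N hN
  have hset : primesWithTrace D r N = ⋃ x₀ ∈ G, classPrimes α M x₀ (N + 1) := by
    ext p; rw [hT, hsets]
  rw [Pi.div_apply, hset, hform N, ← add_div, div_div_div_cancel_right₀ hN.ne', Nat.cast_add]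

/-! ### The value of the quartic character at `D` -/

lemma tau_prod {S : Finset ℕ} (hS : ∀ l ∈ S, l.Prime) :
    tau (∏ l ∈ S, l) = ∏ l ∈ S, tauPrimePow l 1 := by
  have h1 : (∏ l ∈ S, l).primeFactors = S := Nat.primeFactors_prod hS
  rw [tau, h1]
  refine Finset.prod_congr rfl fun l hl => ?_
  rw [Nat.factorization_prod fun q hq => (hS q hq).ne_zero, Finset.sum_apply',
    Finset.sum_eq_single_of_mem l hl, (hS l hl).factorization_self]
  intro q hq hql
  rw [(hS q hq).factorization, Finsupp.single_eq_of_ne hql.symm]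

lemma tauPrimePow_pos {l : ℕ} (hl : l.Prime) : 0 < tauPrimePow l 1 := by
  rw [tauPrimePow]
  split_ifs with h
  · have := hl.two_le
    rw [Nat.sub_self, pow_zero, one_mul]; omega
  · rw [pow_one]; exact hl.pos

/-- The prime `q` with the sign that makes it congruent to `1` modulo `4`. -/
def signedPrime (q : ℕ) : ℤ := ZMod.χ₄ q * q

lemma signedPrime_spec {q : ℕ} (hq : Odd q) :
    signedPrime q ≡ 1 [ZMOD 4] ∧ (signedPrime q).natAbs = q := by
  have h2 := Nat.odd_iff.1 hq
  rw [signedPrime]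
  rcases (show q % 4 = 1 ∨ q % 4 = 3 by omega) with h | h
  · rw [ZMod.χ₄_nat_one_mod_four h, Int.ModEq]; omega
  · rw [ZMod.χ₄_nat_three_mod_four h, Int.ModEq]; omega

lemma prod_signedPrime {S : Finset ℕ} (hS : ∀ l ∈ S, l.Prime ∧ Odd l) :
    ∏ q ∈ S, signedPrime q ≡ 1 [ZMOD 4] ∧ (∏ q ∈ S, signedPrime q).natAbs = ∏ q ∈ S, q := by
  classical
  induction S using Finset.induction_on with
  | empty => exact ⟨by simp [Int.ModEq], by simp⟩
  | insert a S ha ih =>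
    obtain ⟨h1, h2⟩ := ih fun q hq => hS q (Finset.mem_insert_of_mem hq)
    obtain ⟨h3, h4⟩ := signedPrime_spec (hS a (Finset.mem_insert_self a S)).2
    rw [Finset.prod_insert ha, Finset.prod_insert ha, Int.natAbs_mul, h2, h4]
    exact ⟨by simpa using h3.mul h1, rfl⟩

section Main

variable {P Q L : Finset ℕ} {κ : ℕ → ℕ → GaussianInt} {α D ε d : ℤ}

/-- `D` is `± 1` times the corresponding product of signed primes; the sign is decided by
`D` modulo `4`. -/
lemma eq_sign_mul_signedPrime (hε : ε = 1 ∨ ε = -1) (hP : ∀ l ∈ P, l.Prime ∧ Odd l)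
    (hQ : ∀ l ∈ Q, l.Prime ∧ Odd l) (hL : ∀ l ∈ L, l.Prime ∧ Odd l)
    (hD : D = ε * (((∏ l ∈ P, l) * (∏ l ∈ Q, l) ^ 2 * (∏ l ∈ L, l) ^ 3 : ℕ) : ℤ))
    (hd : (d = 1 ∧ D ≡ 1 [ZMOD 4]) ∨ (d = -1 ∧ D ≡ 3 [ZMOD 4])) :
    D = d * ((∏ q ∈ P, signedPrime q) * (∏ q ∈ Q, signedPrime q) ^ 2
      * (∏ q ∈ L, signedPrime q) ^ 3) := by
  obtain ⟨hP1, hP2⟩ := prod_signedPrime hP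
  obtain ⟨hQ1, hQ2⟩ := prod_signedPrime hQ
  obtain ⟨hL1, hL2⟩ := prod_signedPrime hL
  set E := (∏ q ∈ P, signedPrime q) * (∏ q ∈ Q, signedPrime q) ^ 2
      * (∏ q ∈ L, signedPrime q) ^ 3 with hE
  have hE1 : E ≡ 1 [ZMOD 4] := by
    have := (hP1.mul (hQ1.pow 2)).mul (hL1.pow 3)
    simpa using this
  have hE2 : D.natAbs = E.natAbs := by
    rw [hD, hE, Int.natAbs_mul, Int.natAbs_natCast, Int.natAbs_mul, Int.natAbs_mul,
      Int.natAbs_pow, Int.natAbs_pow, hP2, hQ2, hL2]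
    rcases hε with rfl | rfl <;> simp
  rw [Int.ModEq] at hE1 hd hd
  rcases Int.natAbs_eq_natAbs_iff.1 hE2 with h | h <;> rcases hd with ⟨rfl, h1⟩ | ⟨rfl, h1⟩ <;>
    omega

/-- The quartic character with Jacobi sum `α + x i` takes the value `globalSymbol x` at `D`. -/
lemma quartic_apply_eq_globalSymbol {p : ℕ} [Fact p.Prime] (hα : α ≡ 1 [ZMOD 4]) (hp2 : p ≠ 2)
    (hκ : ∀ q, q ∈ P ∨ q ∈ Q ∨ q ∈ L → IsLocalSymbol q α (κ q))
    (hpS : ∀ q, q ∈ P ∨ q ∈ Q ∨ q ∈ L → p ≠ q)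
    (hd : d = 1 ∨ d = -1)
    (hD : D = d * ((∏ q ∈ P, signedPrime q) * (∏ q ∈ Q, signedPrime q) ^ 2
      * (∏ q ∈ L, signedPrime q) ^ 3))
    {x : ℕ} (hpx : (p : ℤ) = α ^ 2 + (x : ℤ) ^ 2) {χ : MulChar (ZMod p) GaussianInt}
    (hχ : orderOf χ = 4) (hJ : normalizedJacobi χ = ⟨α, x⟩) :
    χ D = globalSymbol d κ P Q L x := by
  have h8 := mod_eight_of_sum_sq hα hp2 hpx
  have hneg := quartic_neg_one (by omega) hχ
  have htwo : χ d = twoSymbol d x := by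
    rw [twoSymbol]
    rcases hd with rfl | rfl
    · push_cast
      rw [map_one]
      split_ifs
      · rfl
      · rfl
      · omega
    · push_cast
      rw [hneg]
      split_ifs <;> first | rfl | omega
  have hrec : ∀ q, q ∈ P ∨ q ∈ Q ∨ q ∈ L → χ (signedPrime q : ZMod p) = κ q x := fun q hq =>
    (hκ q hq).reciprocity p χ hχ (hpS q hq) x hJ
  rw [hD]
  push_cast
  simp only [map_mul, map_pow, map_prod]
  rw [htwo, globalSymbol, Finset.prod_congr rfl fun q hq => hrec q (Or.inl hq),
    Finset.prod_congr rfl fun q hq => hrec q (Or.inr (Or.inl hq)),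
    Finset.prod_congr rfl fun q hq => hrec q (Or.inr (Or.inr hq)), Finset.prod_pow,
    Finset.prod_pow]
  ring

lemma globalSymbol_periodic (hκ : ∀ q, q ∈ P ∨ q ∈ Q ∨ q ∈ L → IsLocalSymbol q α (κ q))
    (δ : GaussianInt) : Function.Periodic (globalSymbol δ κ P Q L) (modulus P Q L) := by
  have h : ∀ q, q ∈ P ∨ q ∈ Q ∨ q ∈ L → q ∣ modulus P Q L := by
    rintro q (hq | hq | hq)
    · exact (((Finset.dvd_prod_of_mem _ hq).mul_left 4).mul_right _).mul_right _
    · exact ((Finset.dvd_prod_of_mem _ hq).mul_left _).mul_right _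
    · exact (Finset.dvd_prod_of_mem _ hq).mul_left _
  have h4 : 4 ∣ modulus P Q L := ((Dvd.intro _ rfl).mul_right _).mul_right _
  intro x
  rw [globalSymbol, globalSymbol, periodic_of_dvd (twoSymbol_periodic δ) h4 x,
    Finset.prod_congr rfl fun q hq =>
      periodic_of_dvd (hκ q (Or.inl hq)).periodic (h q (Or.inl hq)) x,
    Finset.prod_congr rfl fun q hq => congrArg (· ^ 2)
      (periodic_of_dvd (hκ q (Or.inr (Or.inl hq))).periodic (h q (Or.inr (Or.inl hq))) x),
    Finset.prod_congr rfl fun q hq => congrArg (· ^ 3)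
      (periodic_of_dvd (hκ q (Or.inr (Or.inr hq))).periodic (h q (Or.inr (Or.inr hq))) x)]

lemma prime_dvd_modulus (hP : ∀ l ∈ P, l.Prime ∧ Odd l) (hQ : ∀ l ∈ Q, l.Prime ∧ Odd l)
    (hL : ∀ l ∈ L, l.Prime ∧ Odd l) {p : ℕ} (hp : p.Prime) :
    p ∣ modulus P Q L ↔ p = 2 ∨ p ∈ P ∨ p ∈ Q ∨ p ∈ L := by
  have hS : ∀ S : Finset ℕ, (∀ l ∈ S, l.Prime ∧ Odd l) → (p ∣ ∏ q ∈ S, q ↔ p ∈ S) := by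
    intro S hS
    rw [hp.prime.dvd_finsetProd_iff]
    constructor
    · rintro ⟨q, hq, h⟩
      rwa [(Nat.prime_dvd_prime_iff_eq hp (hS q hq).1).1 h]
    · exact fun h => ⟨p, h, dvd_rfl⟩
  have h4 : p ∣ 4 ↔ p = 2 := by
    rw [show 4 = 2 ^ 2 from rfl, hp.prime.dvd_pow_iff_dvd two_ne_zero,
      Nat.prime_dvd_prime_iff_eq hp Nat.prime_two]
  rw [modulus, hp.dvd_mul, hp.dvd_mul, hp.dvd_mul, hS P hP, hS Q hQ, hS L hL, h4]
  tauto

/-- The global symbol is nonzero exactly on the admissible residue classes. -/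
lemma coprime_modulus_iff (hα : α ≡ 1 [ZMOD 4]) (hP : ∀ l ∈ P, l.Prime ∧ Odd l)
    (hQ : ∀ l ∈ Q, l.Prime ∧ Odd l) (hL : ∀ l ∈ L, l.Prime ∧ Odd l)
    (hκ : ∀ q, q ∈ P ∨ q ∈ Q ∨ q ∈ L → IsLocalSymbol q α (κ q)) {δ : GaussianInt}
    (hδ : δ ^ 2 = 1) (x : ℕ) :
    globalSymbol δ κ P Q L x ≠ 0 ↔ Nat.Coprime (x ^ 2 + α.natAbs ^ 2) (modulus P Q L) := by
  have hα' : α % 4 = 1 := hα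
  have hodd : α.natAbs % 2 = 1 := by omega
  have hcast : ∀ q : ℕ, q ∣ x ^ 2 + α.natAbs ^ 2 ↔ (q : ℤ) ∣ (x : ℤ) ^ 2 + α ^ 2 := fun q => by
    rw [← Int.natCast_dvd_natCast]; push_cast; rw [sq_abs]
  have hpar : (x ^ 2 + α.natAbs ^ 2) % 2 = (x + 1) % 2 := by
    rw [Nat.add_mod, Nat.pow_mod α.natAbs, hodd, Nat.pow_mod x]
    rcases Nat.mod_two_eq_zero_or_one x with h | h <;> rw [h] <;> omega
  rcases globalSymbol_cases (P := P) (Q := Q) (L := L) hκ hδ x with ⟨h0, h⟩ | ⟨h4, hx, h⟩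
  · simp only [h0, ne_eq, not_true_eq_false, false_iff]
    rcases h with h | ⟨q, hq, hdvd⟩
    · exact Nat.not_coprime_of_dvd_of_dvd one_lt_two (by omega)
        ((prime_dvd_modulus hP hQ hL Nat.prime_two).2 (Or.inl rfl))
    · have hqp : q.Prime := by
        rcases hq with hq | hq | hq
        exacts [(hP q hq).1, (hQ q hq).1, (hL q hq).1]
      exact Nat.not_coprime_of_dvd_of_dvd hqp.one_lt ((hcast q).2 hdvd)
        ((prime_dvd_modulus hP hQ hL hqp).2 (Or.inr hq))
  · have hne : globalSymbol δ κ P Q L x ≠ 0 := by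
      intro h0; rw [h0] at h4; norm_num at h4
    simp only [hne, ne_eq, not_false_eq_true, true_iff]
    refine Nat.Coprime.symm (Nat.coprime_of_dvd fun p hp hpM hpx => ?_)
    rcases (prime_dvd_modulus hP hQ hL hp).1 hpM with rfl | hq
    · omega
    · exact h p hq ((hcast p).1 hpx)

lemma mem_primesWithTrace_iff (hα : α ≡ 1 [ZMOD 4]) (hP : ∀ l ∈ P, l.Prime ∧ Odd l)
    (hQ : ∀ l ∈ Q, l.Prime ∧ Odd l) (hL : ∀ l ∈ L, l.Prime ∧ Odd l)
    (hκ : ∀ q, q ∈ P ∨ q ∈ Q ∨ q ∈ L → IsLocalSymbol q α (κ q)) (hd : d = 1 ∨ d = -1)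
    (hD : D = d * ((∏ q ∈ P, signedPrime q) * (∏ q ∈ Q, signedPrime q) ^ 2
      * (∏ q ∈ L, signedPrime q) ^ 3)) {s : ℤ} (hs : s = 1 ∨ s = -1) (N p : ℕ) :
    p ∈ primesWithTrace D (s * α) N ↔ p.Prime ∧ p ≤ N ∧
      ∃ x : ℕ, (p : ℤ) = α ^ 2 + (x : ℤ) ^ 2 ∧ x % modulus P Q L ∈
        (Finset.range (modulus P Q L)).filter fun x => globalSymbol d κ P Q L x = (s : ℤ) := by
  have hα' : α % 4 = 1 := hα
  have hs2 : s ^ 2 = 1 := by rcases hs with rfl | rfl <;> norm_num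
  have hδ : ((d : ℤ) : GaussianInt) ^ 2 = 1 := by rcases hd with rfl | rfl <;> norm_num
  have hMpos : 0 < modulus P Q L := by
    have h1 : 0 < ∏ p ∈ P, p := Finset.prod_pos fun q hq => (hP q hq).1.pos
    have h2 : 0 < ∏ p ∈ Q, p := Finset.prod_pos fun q hq => (hQ q hq).1.pos
    have h3 : 0 < ∏ p ∈ L, p := Finset.prod_pos fun q hq => (hL q hq).1.pos
    rw [modulus]; positivity
  have hmem : ∀ x : ℕ, x % modulus P Q L ∈ ((Finset.range (modulus P Q L)).filter
      fun x => globalSymbol d κ P Q L x = (s : ℤ)) ↔ globalSymbol d κ P Q L x = (s : ℤ) := by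
    intro x
    rw [Finset.mem_filter, Finset.mem_range, (globalSymbol_periodic hκ _).map_mod_nat]
    exact and_iff_right (Nat.mod_lt _ hMpos)
  simp only [hmem]
  -- the primes of bad reduction are those dividing the modulus
  have hbad : ∀ p : ℕ, p.Prime → ((p : ℤ) ∣ 2 * D ↔ p = 2 ∨ p ∈ P ∨ p ∈ Q ∨ p ∈ L) := by
    intro p hp
    obtain ⟨_, hP2⟩ := prod_signedPrime hP
    obtain ⟨_, hQ2⟩ := prod_signedPrime hQ
    obtain ⟨_, hL2⟩ := prod_signedPrime hL
    rw [← prime_dvd_modulus hP hQ hL hp, hD, Int.natCast_dvd, modulus]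
    have hd1 : d.natAbs = 1 := by rcases hd with rfl | rfl <;> rfl
    simp only [Int.natAbs_mul, Int.natAbs_pow, hP2, hQ2, hL2, hd1, one_mul]
    rw [show Int.natAbs 2 = 2 from rfl, hp.dvd_mul, hp.dvd_mul, hp.dvd_mul,
      hp.prime.dvd_pow_iff_dvd two_ne_zero, hp.prime.dvd_pow_iff_dvd three_ne_zero, hp.dvd_mul,
      hp.dvd_mul, hp.dvd_mul, show 4 = 2 ^ 2 from rfl, hp.prime.dvd_pow_iff_dvd two_ne_zero]
    tauto
  have htrace : ∀ p : ℕ, p.Prime → ∀ x : ℕ, (p : ℤ) = α ^ 2 + (x : ℤ) ^ 2 →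
      ¬ (p : ℤ) ∣ 2 * D →
      (frobeniusTrace D p = 2 * (s * α) ↔ globalSymbol d κ P Q L x = (s : ℤ)) := by
    intro p hp x hpx hpD
    have : Fact p.Prime := ⟨hp⟩
    have hpb := (hbad p hp).not.1 hpD
    have hp2 : p ≠ 2 := fun h => hpb (Or.inl h)
    obtain ⟨χ, hχ, hJ⟩ := exists_quartic_normalizedJacobi hα hp2 hpx
    rw [← quartic_apply_eq_globalSymbol hα hp2 hκ (fun q hq h => hpb (Or.inr (h ▸ hq))) hd hD hpx
      hχ hJ]
    have h := frobeniusTrace_eq_iff hα hpx hχ hJ D hpD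
    rcases hs with rfl | rfl
    · rw [one_mul, Int.cast_one]; exact h.1
    · rw [neg_one_mul, Int.cast_neg, Int.cast_one]; exact h.2
  constructor
  · rintro ⟨⟨hp, hN, x, hx⟩, hpD, htr⟩
    have hx' : (p : ℤ) = α ^ 2 + (x.natAbs : ℤ) ^ 2 := by
      rw [hx, Int.natAbs_sq, mul_pow, hs2, one_mul]
    exact ⟨hp, hN, x.natAbs, hx', (htrace p hp _ hx' hpD).1 htr⟩
  · rintro ⟨hp, hN, x, hx, hW⟩
    have hne : globalSymbol d κ P Q L x ≠ 0 := by
      rw [hW]; rcases hs with rfl | rfl <;> decide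
    have hpD : ¬ (p : ℤ) ∣ 2 * D := by
      rw [hbad p hp, ← prime_dvd_modulus hP hQ hL hp]
      have hcop := (coprime_modulus_iff hα hP hQ hL hκ hδ x).1 hne
      have hpN : x ^ 2 + α.natAbs ^ 2 = p := by
        have : ((x ^ 2 + α.natAbs ^ 2 : ℕ) : ℤ) = p := by
          rw [hx]; push_cast; rw [sq_abs]; ring
        exact_mod_cast this
      rw [hpN] at hcop
      exact fun h => hp.one_lt.ne' (Nat.Coprime.eq_one_of_dvd hcop h)
    exact ⟨⟨hp, hN, x, by rw [hx, mul_pow, hs2, one_mul]⟩, hpD, (htrace p hp x hx hpD).2 hW⟩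

/-- The two densities, uniformly in the sign `d ≡ D (mod 4)`. -/
theorem hasTraceDensity_sign (hHL : HardyLittlewoodConjecture) (hα : α ≡ 1 [ZMOD 4])
    (hP : ∀ l ∈ P, l.Prime ∧ Odd l) (hQ : ∀ l ∈ Q, l.Prime ∧ Odd l)
    (hL : ∀ l ∈ L, l.Prime ∧ Odd l) (hPQ : Disjoint P Q) (hPL : Disjoint P L) (hQL : Disjoint Q L)
    (hαS : ∀ q : ℕ, q ∈ P ∨ q ∈ Q ∨ q ∈ L → ¬ (q : ℤ) ∣ α) (hd : d = 1 ∨ d = -1)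
    (hD : D = d * ((∏ q ∈ P, signedPrime q) * (∏ q ∈ Q, signedPrime q) ^ 2
      * (∏ q ∈ L, signedPrime q) ^ 3)) {s : ℤ} (hs : s = 1 ∨ s = -1) :
    HasTraceDensity D (s * α) (1 / 4 * (1
      + (-1 : ℝ) ^ (P.card + L.card) / (tau ((∏ l ∈ P, l) * ∏ l ∈ L, l) : ℝ)
      + s * ((1 + d) * (-1 : ℝ) ^ (countMod8 P 1 + countMod8 P 7 + Q.card
          + countMod8 L 1 + countMod8 L 7)
        / (tau ((∏ l ∈ P, l) * (∏ l ∈ Q, l) * ∏ l ∈ L, l) : ℝ)))) := by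
  classical
  have hsym : ∀ q : ℕ, ∃ κ : ℕ → GaussianInt, q ∈ P ∨ q ∈ Q ∨ q ∈ L → IsLocalSymbol q α κ := by
    intro q
    by_cases hq : q ∈ P ∨ q ∈ Q ∨ q ∈ L
    · have hqp : q.Prime ∧ Odd q := by
        rcases hq with hq | hq | hq
        exacts [hP q hq, hQ q hq, hL q hq]
      obtain ⟨κ, hκ⟩ := exists_isLocalSymbol hqp.1
        (by rintro rfl; exact absurd hqp.2 (by decide)) (hαS q hq)
      exact ⟨κ, fun _ => hκ⟩
    · exact ⟨0, fun h => absurd h hq⟩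
  choose κ hκ using hsym
  have hα' : α % 4 = 1 := hα
  have hα0 : α ≠ 0 := by rintro rfl; norm_num at hα'
  have hs2 : s ^ 2 = 1 := by rcases hs with rfl | rfl <;> norm_num
  have hδ : ((d : ℤ) : GaussianInt) ^ 2 = 1 := by rcases hd with rfl | rfl <;> norm_num
  have hMpos : 0 < modulus P Q L := by
    have h1 : 0 < ∏ p ∈ P, p := Finset.prod_pos fun q hq => (hP q hq).1.pos
    have h2 : 0 < ∏ p ∈ Q, p := Finset.prod_pos fun q hq => (hQ q hq).1.pos
    have h3 : 0 < ∏ p ∈ L, p := Finset.prod_pos fun q hq => (hL q hq).1.pos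
    rw [modulus]; positivity
  have hMe : Even (modulus P Q L) :=
    even_iff_two_dvd.2 ((prime_dvd_modulus hP hQ hL Nat.prime_two).2 (Or.inl rfl))
  set M := modulus P Q L
  set W := globalSymbol (d : ℤ) κ P Q L
  set A := (Finset.range M).filter fun x => W x ≠ 0
  set G := (Finset.range M).filter fun x => W x = (s : ℤ)
  have hW : ∀ x ∈ Finset.range M, W x = 0 ∨ W x ^ 4 = 1 := fun x _ =>
    (globalSymbol_cases hκ hδ x).imp And.left And.left
  obtain ⟨hG1, hG2, hA⟩ := four_mul_card_filter hW
  obtain ⟨m4, m2, m13⟩ := globalSymbol_moments hP hQ hL hPQ hPL hQL hκ hδ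
  rw [m4, m2, m13] at hG1 hG2
  rw [m4] at hA
  have hGA : G ⊆ A := by
    intro x hx
    rw [Finset.mem_filter] at hx ⊢
    refine ⟨hx.1, ?_⟩
    rw [hx.2]; rcases hs with rfl | rfl <;> decide
  have htP : 0 < ∏ q ∈ P, tauPrimePow q 1 := Finset.prod_pos fun q hq => tauPrimePow_pos (hP q hq).1
  have htQ : 0 < ∏ q ∈ Q, tauPrimePow q 1 := Finset.prod_pos fun q hq => tauPrimePow_pos (hQ q hq).1
  have htL : 0 < ∏ q ∈ L, tauPrimePow q 1 := Finset.prod_pos fun q hq => tauPrimePow_pos (hL q hq).1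
  have hAc : A.card = 2 * (∏ q ∈ P, tauPrimePow q 1) * (∏ q ∈ Q, tauPrimePow q 1)
      * ∏ q ∈ L, tauPrimePow q 1 := by exact_mod_cast hA
  have hA0 : A.Nonempty := Finset.card_pos.1 (by rw [hAc]; positivity)
  have hGc : 4 * (G.card : ℤ) = 2 * ((∏ q ∈ P, tauPrimePow q 1 : ℕ) : ℤ)
      * ((∏ q ∈ Q, tauPrimePow q 1 : ℕ) : ℤ) * ((∏ q ∈ L, tauPrimePow q 1 : ℕ) : ℤ)
      + 2 * (-1) ^ (P.card + L.card) * ((∏ q ∈ Q, tauPrimePow q 1 : ℕ) : ℤ)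
      + s * (2 * (1 + d) * (-1) ^ (countMod8 P 1 + countMod8 P 7 + Q.card
            + countMod8 L 1 + countMod8 L 7)) := by
    rcases hs with rfl | rfl
    · have h : G = (Finset.range M).filter fun x => W x = 1 := by simp only [G, Int.cast_one]
      rw [h, one_mul]; exact_mod_cast hG1
    · have h : G = (Finset.range M).filter fun x => W x = -1 := by
        simp only [G, Int.cast_neg, Int.cast_one]
      rw [h, neg_one_mul, ← sub_eq_add_neg]; exact_mod_cast hG2
  have hPLp : ∀ l ∈ P ∪ L, l.Prime := fun l hl =>
    (Finset.mem_union.1 hl).elim (fun h => (hP l h).1) (fun h => (hL l h).1)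
  have hPQLp : ∀ l ∈ (P ∪ Q) ∪ L, l.Prime := fun l hl =>
    (Finset.mem_union.1 hl).elim (fun h => (Finset.mem_union.1 h).elim (fun h => (hP l h).1)
      fun h => (hQ l h).1) (fun h => (hL l h).1)
  have hPQ_L : Disjoint (P ∪ Q) L := Finset.disjoint_union_left.2 ⟨hPL, hQL⟩
  rw [← Finset.prod_union hPL, ← Finset.prod_union hPQ, ← Finset.prod_union hPQ_L,
    tau_prod hPLp, tau_prod hPQLp, Finset.prod_union hPL, Finset.prod_union hPQ_L,
    Finset.prod_union hPQ]
  have hdens := hasTraceDensity_of_residues (r := s * α) (D := D) hHL hα0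
    (by rw [mul_pow, hs2, one_mul]) hMpos hMe (A := A) (G := G)
    (Finset.filter_congr fun x _ => coprime_modulus_iff hα hP hQ hL hκ hδ x) hA0 hGA
    (mem_primesWithTrace_iff hα hP hQ hL hκ hd hD hs)
  convert hdens using 1
  have hGc' := congrArg (Int.cast (R := ℝ)) hGc
  simp only [Int.cast_add, Int.cast_mul, Int.cast_pow, Int.cast_neg, Int.cast_one, Int.cast_ofNat,
    Int.cast_natCast] at hGc'
  rw [hAc]
  simp only [Nat.cast_mul, Nat.cast_ofNat]
  have htP' : (0 : ℝ) < ((∏ q ∈ P, tauPrimePow q 1 : ℕ) : ℝ) := by exact_mod_cast htP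
  have htQ' : (0 : ℝ) < ((∏ q ∈ Q, tauPrimePow q 1 : ℕ) : ℝ) := by exact_mod_cast htQ
  have htL' : (0 : ℝ) < ((∏ q ∈ L, tauPrimePow q 1 : ℕ) : ℝ) := by exact_mod_cast htL
  generalize ((∏ q ∈ P, tauPrimePow q 1 : ℕ) : ℝ) = tP at *
  generalize ((∏ q ∈ Q, tauPrimePow q 1 : ℕ) : ℝ) = tQ at *
  generalize ((∏ q ∈ L, tauPrimePow q 1 : ℕ) : ℝ) = tL at *
  rw [eq_div_iff (by positivity)]
  field_simp
  linear_combination -hGc'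

end Main

end LangTrotter

theorem mainTheorem5
    (hHL : LangTrotter.HardyLittlewoodConjecture)
    (ε : ℤ) (hε : ε = 1 ∨ ε = -1) (P Q L : Finset ℕ)
    (hP : ∀ l ∈ P, l.Prime ∧ Odd l) (hQ : ∀ l ∈ Q, l.Prime ∧ Odd l)
    (hL : ∀ l ∈ L, l.Prime ∧ Odd l)
    (hPQ : Disjoint P Q) (hPL : Disjoint P L) (hQL : Disjoint Q L)
    (D : ℤ)
    (hD : D = ε * (((∏ l ∈ P, l) * (∏ l ∈ Q, l) ^ 2 * (∏ l ∈ L, l) ^ 3 : ℕ) : ℤ))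
    (α : ℤ) (hα : α ≡ 1 [ZMOD 4]) (hDα : Int.gcd D α = 1) :
    (D ≡ 1 [ZMOD 4] →
      LangTrotter.HasTraceDensity D α
        (1 / 4 * (1
          + (-1 : ℝ) ^ (P.card + L.card)
            / (LangTrotter.tau ((∏ l ∈ P, l) * ∏ l ∈ L, l) : ℝ)
          + 2 * (-1 : ℝ) ^ (LangTrotter.countMod8 P 1 + LangTrotter.countMod8 P 7 + Q.card
                + LangTrotter.countMod8 L 1 + LangTrotter.countMod8 L 7)
            / (LangTrotter.tau ((∏ l ∈ P, l) * (∏ l ∈ Q, l) * ∏ l ∈ L, l) : ℝ))) ∧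
      LangTrotter.HasTraceDensity D (-α)
        (1 / 4 * (1
          + (-1 : ℝ) ^ (P.card + L.card)
            / (LangTrotter.tau ((∏ l ∈ P, l) * ∏ l ∈ L, l) : ℝ)
          - 2 * (-1 : ℝ) ^ (LangTrotter.countMod8 P 1 + LangTrotter.countMod8 P 7 + Q.card
                + LangTrotter.countMod8 L 1 + LangTrotter.countMod8 L 7)
            / (LangTrotter.tau ((∏ l ∈ P, l) * (∏ l ∈ Q, l) * ∏ l ∈ L, l) : ℝ)))) ∧
    (D ≡ 3 [ZMOD 4] →
      LangTrotter.HasTraceDensity D α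
        (1 / 4 * (1
          + (-1 : ℝ) ^ (P.card + L.card)
            / (LangTrotter.tau ((∏ l ∈ P, l) * ∏ l ∈ L, l) : ℝ))) ∧
      LangTrotter.HasTraceDensity D (-α)
        (1 / 4 * (1
          + (-1 : ℝ) ^ (P.card + L.card)
            / (LangTrotter.tau ((∏ l ∈ P, l) * ∏ l ∈ L, l) : ℝ)))) := by
  have hαS : ∀ q : ℕ, q ∈ P ∨ q ∈ Q ∨ q ∈ L → ¬ (q : ℤ) ∣ α := by
    intro q hq hqα
    have hqp : q.Prime := by
      rcases hq with hq | hq | hq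
      exacts [(hP q hq).1, (hQ q hq).1, (hL q hq).1]
    have hqD : (q : ℤ) ∣ D := by
      rw [hD]
      refine Dvd.dvd.mul_left (Int.natCast_dvd_natCast.2 ?_) ε
      rcases hq with hq | hq | hq
      · exact ((Finset.dvd_prod_of_mem _ hq).mul_right _).mul_right _
      · exact (((Finset.dvd_prod_of_mem _ hq).pow two_ne_zero).mul_left _).mul_right _
      · exact ((Finset.dvd_prod_of_mem _ hq).pow three_ne_zero).mul_left _
    have h := Int.dvd_gcd hqD hqα
    rw [hDα] at h
    exact hqp.one_lt.ne' (Nat.dvd_one.1 h)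
  have hmain : ∀ d s : ℤ, (d = 1 ∧ D ≡ 1 [ZMOD 4]) ∨ (d = -1 ∧ D ≡ 3 [ZMOD 4]) →
      s = 1 ∨ s = -1 → _ := fun d s hd hs =>
    LangTrotter.hasTraceDensity_sign hHL hα hP hQ hL hPQ hPL hQL hαS (hd.imp And.left And.left)
      (LangTrotter.eq_sign_mul_signedPrime hε hP hQ hL hD hd) hs
  refine ⟨fun h1 => ⟨?_, ?_⟩, fun h3 => ⟨?_, ?_⟩⟩
  · convert hmain 1 1 (Or.inl ⟨rfl, h1⟩) (Or.inl rfl) using 1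
    · rw [one_mul]
    · push_cast; ring
  · convert hmain 1 (-1) (Or.inl ⟨rfl, h1⟩) (Or.inr rfl) using 1
    · rw [neg_one_mul]
    · push_cast; ring
  · convert hmain (-1) 1 (Or.inr ⟨rfl, h3⟩) (Or.inl rfl) using 1
    · rw [one_mul]
    · push_cast; ring
  · convert hmain (-1) (-1) (Or.inr ⟨rfl, h3⟩) (Or.inr rfl) using 1
    · rw [neg_one_mul]
    · push_cast; ring
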